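/- Let $L_O$ be the two-sorted language with a field sort $K$ (language of rings), a vector space sort $V$ (language of abelian groups), scalar multiplication $K\times V\to V$, a function symbol $q:V\to K$, and, for all $1\le i\le n$, an $n$-ary predicate $\theta_n$ on $V$ and an $(n+1)$-ary function symbol $\pi_{n,i}:V^{n+1}\to K$. Let $T^0_O$ be the $L_O$-theory asserting that $K$ is a field of characteristic $2$; that $V$ is a $K$-vector space; that $\theta_n(v_1,\dots,v_n)$ holds if and only if $v_1,\dots,v_n$ are linearly independent; that $\pi_{n,i}(v_1,\dots,v_n,w)=\alpha_i$ if $v_1,\dots,v_n$ are linearly independent and $w=\sum_j\alpha_jv_j$, and $\pi_{n,i}(v_1,\dots,v_n,w)=0$ otherwise; and that $q$ is a quadratic form on $V$ whose associated form $\beta(x,y)=q(x+y)-q(x)-q(y)$ is a non-degenerate symmetric bilinear form. A model $M=(V,K,q)$ of $T^0_O$ is called pseudo-finite if it is infinite and every $L_O$-sentence true in $M$ is true in some finite model of $T^0_O$. Let $\mathrm{PSF}_2$ be the theory of pseudo-finite fields of characteristic $2$ (the infinite models of the theory of all finite fields of characteristic $2$). If $\dim V=2n$ is finite, the Witt defect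 of $V$ is $n-r$, where $r$ is the largest dimension of a subspace of $V$ on which $q$ vanishes identically. Suppose that $M\models T^0_O$ is pseudo-finite. Then $\mathrm{Th}(M)$ is axiomatized, modulo $T^0_O$, by one of the following: 1. for some $k\ge 1$, the statement that $K$ is a finite field with $2^k$ elements and that $V$ has infinite dimension; 2. for some completion $T$ of $\mathrm{PSF}_2$, the statement that $K\models T$ together with one of the following: (a) for some $n\ge 0$ and some $e\in\{0,1\}$ with $e\le n$, the statement that $\dim V=2n$ and that the Witt defect of $V$ is $e$; (b) the statement that $V$ has infinite dimension. Moreover, all of these possibilities are realized: for every $k\ge1$ in case 1, for every completion $T$ of $\mathrm{PSF}_2$ and all $n\ge 0$, $e\in\{0,1\}$ with $e\le n$ in case 2(a), and for every completion $T$ of $\mathrm{PSF}_2$ in case 2(b), there is a pseudo-finite $M\models T^0_O$ whose complete theory is axiomatized, modulo $T^0_O$, by the listed statements. -/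

import Mathlib

open FirstOrder

universe u

namespace OrthogonalSpaces

/-! ### The two-sorted language of orthogonal spaces -/

/-- The two sorts: the field sort `K` and the vector space sort `V`. -/
inductive LSort : Type
  | K
  | V

/-- `L_O`-terms, indexed by their sort, in `m` variables of sort `K` and `n` variables of sort `V`.
The symbols are: the function symbols of the language of rings on `K`; `0`, `+`, `-` on `V`;
scalar multiplication `K × V → V`; the quadratic form `q : V → K`; and, for every `k` and
`i < k + 1`, the coordinate function `π_{k+1,i} : V^{k+1} × V → K`. -/
inductive LTerm (m n : ℕ) : LSort → Type
  | fvar (i : Fin m) : LTerm m n LSort.K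
  | vvar (i : Fin n) : LTerm m n LSort.V
  | ringFun {k : ℕ} (f : Language.ring.Functions k) (ts : Fin k → LTerm m n LSort.K) :
      LTerm m n LSort.K
  | vzero : LTerm m n LSort.V
  | vadd (t₁ t₂ : LTerm m n LSort.V) : LTerm m n LSort.V
  | vneg (t : LTerm m n LSort.V) : LTerm m n LSort.V
  | smul (a : LTerm m n LSort.K) (t : LTerm m n LSort.V) : LTerm m n LSort.V
  | q (t : LTerm m n LSort.V) : LTerm m n LSort.K
  | coord (k : ℕ) (i : Fin (k + 1)) (ts : Fin (k + 1) → LTerm m n LSort.V)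
      (w : LTerm m n LSort.V) : LTerm m n LSort.K

/-- First-order `L_O`-formulas with free variables among `m` variables of sort `K` and
`n` variables of sort `V`. The atomic formulas are equations in either sort and
`θ_{k+1}(t₀, …, t_k)`, for the linear independence predicates. A quantifier binds the last
variable of its sort. -/
inductive LFormula : ℕ → ℕ → Type
  | falsum {m n : ℕ} : LFormula m n
  | eqK {m n : ℕ} (t₁ t₂ : LTerm m n LSort.K) : LFormula m n
  | eqV {m n : ℕ} (t₁ t₂ : LTerm m n LSort.V) : LFormula m n
  | theta {m n : ℕ} (k : ℕ) (ts : Fin (k + 1) → LTerm m n LSort.V) : LFormula m n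
  | imp {m n : ℕ} (φ ψ : LFormula m n) : LFormula m n
  | allK {m n : ℕ} (φ : LFormula (m + 1) n) : LFormula m n
  | allV {m n : ℕ} (φ : LFormula m (n + 1)) : LFormula m n

/-- `L_O`-sentences. -/
abbrev LSentence : Type := LFormula 0 0

/-- `L_O`-structures: arbitrary interpretations of all the symbols of the language. -/
structure LStructure : Type (u + 1) where
  K : Type u
  V : Type u
  ringStructure : Language.ring.Structure K
  vzero : V
  vadd : V → V → V
  vneg : V → V
  smul : K → V → V
  q : V → K
  theta : (k : ℕ) → (Fin (k + 1) → V) → Prop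
  coord : (k : ℕ) → Fin (k + 1) → (Fin (k + 1) → V) → V → K

attribute [instance] LStructure.ringStructure

/-- The carrier of a sort. -/
abbrev LStructure.carrier (M : LStructure.{u}) : LSort → Type u
  | LSort.K => M.K
  | LSort.V => M.V

/-- The value of a term under an assignment. -/
def LTerm.realize (M : LStructure.{u}) {m n : ℕ} (a : Fin m → M.K) (v : Fin n → M.V) :
    {s : LSort} → LTerm m n s → M.carrier s
  | _, .fvar i => a i
  | _, .vvar i => v i
  | _, .ringFun f ts => Language.Structure.funMap (M := M.K) f fun i => (ts i).realize M a v
  | _, .vzero => M.vzero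
  | _, .vadd t₁ t₂ => M.vadd (t₁.realize M a v) (t₂.realize M a v)
  | _, .vneg t => M.vneg (t.realize M a v)
  | _, .smul c t => M.smul (c.realize M a v) (t.realize M a v)
  | _, .q t => M.q (t.realize M a v)
  | _, .coord k i ts w => M.coord k i (fun j => (ts j).realize M a v) (w.realize M a v)

/-- Tarski's definition of truth. -/
def LFormula.Realize (M : LStructure.{u}) :
    {m n : ℕ} → LFormula m n → (Fin m → M.K) → (Fin n → M.V) → Prop
  | _, _, .falsum, _, _ => False
  | _, _, .eqK t₁ t₂, a, v => t₁.realize M a v = t₂.realize M a v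
  | _, _, .eqV t₁ t₂, a, v => t₁.realize M a v = t₂.realize M a v
  | _, _, .theta k ts, a, v => M.theta k fun j => (ts j).realize M a v
  | _, _, .imp φ ψ, a, v => φ.Realize M a v → ψ.Realize M a v
  | _, _, .allK φ, a, v => ∀ x : M.K, φ.Realize M (Fin.snoc (α := fun _ => M.K) a x) v
  | _, _, .allV φ, a, v => ∀ x : M.V, φ.Realize M a (Fin.snoc (α := fun _ => M.V) v x)

/-- `M ⊨ φ` for a sentence `φ`. -/
def LStructure.Satisfies (M : LStructure.{u}) (φ : LSentence) : Prop :=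
  φ.Realize M Fin.elim0 Fin.elim0

/-- `M ⊨ Γ` for a set `Γ` of sentences. -/
def LStructure.IsModel (M : LStructure.{u}) (Γ : Set LSentence) : Prop :=
  ∀ φ ∈ Γ, M.Satisfies φ

/-- `Γ ⊨ φ`: the sentence `φ` holds in every model of `Γ`. -/
def Entails (Γ : Set LSentence) (φ : LSentence) : Prop :=
  ∀ N : LStructure.{u}, N.IsModel Γ → N.Satisfies φ

/-- The complete theory `Th(M)`. -/
def LStructure.completeTheory (M : LStructure.{u}) : Set LSentence :=
  {φ | M.Satisfies φ}

/-! ### Derived connectives and abbreviations -/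

namespace LFormula

variable {m n : ℕ}

def not (φ : LFormula m n) : LFormula m n := φ.imp falsum
def top : LFormula m n := falsum.not
def and (φ ψ : LFormula m n) : LFormula m n := (φ.imp ψ.not).not
def iff (φ ψ : LFormula m n) : LFormula m n := (φ.imp ψ).and (ψ.imp φ)
def exK (φ : LFormula (m + 1) n) : LFormula m n := φ.not.allK.not
def exV (φ : LFormula m (n + 1)) : LFormula m n := φ.not.allV.not

/-- The conjunction of `φ 0, …, φ (k - 1)`. -/
def conj {k : ℕ} (φ : Fin k → LFormula m n) : LFormula m n := (List.ofFn φ).foldr and top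

/-- Quantify universally over all variables of sort `K`. -/
def allsK : {m : ℕ} → LFormula m n → LFormula 0 n
  | 0, φ => φ
  | _ + 1, φ => allsK φ.allK

/-- Quantify existentially over all variables of sort `K`. -/
def exsK : {m : ℕ} → LFormula m n → LFormula 0 n
  | 0, φ => φ
  | _ + 1, φ => exsK φ.exK

/-- Quantify universally over all variables of sort `V`. -/
def allsV : {n : ℕ} → LFormula m n → LFormula m 0
  | 0, φ => φ
  | _ + 1, φ => allsV φ.allV

/-- Quantify existentially over all variables of sort `V`. -/
def exsV : {n : ℕ} → LFormula m n → LFormula m 0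
  | 0, φ => φ
  | _ + 1, φ => exsV φ.exV

/-- The universal closure. -/
def univ (φ : LFormula m n) : LSentence := φ.allsK.allsV

end LFormula

namespace LTerm

variable {m n : ℕ}

instance : Zero (LTerm m n LSort.K) := ⟨ringFun Ring.zeroFunc ![]⟩
instance : One (LTerm m n LSort.K) := ⟨ringFun Ring.oneFunc ![]⟩
instance : Add (LTerm m n LSort.K) := ⟨fun s t => ringFun Ring.addFunc ![s, t]⟩
instance : Mul (LTerm m n LSort.K) := ⟨fun s t => ringFun Ring.mulFunc ![s, t]⟩
instance : Neg (LTerm m n LSort.K) := ⟨fun t => ringFun Ring.negFunc ![t]⟩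
instance : Zero (LTerm m n LSort.V) := ⟨vzero⟩
instance : Add (LTerm m n LSort.V) := ⟨vadd⟩
instance : Neg (LTerm m n LSort.V) := ⟨vneg⟩
instance : SMul (LTerm m n LSort.K) (LTerm m n LSort.V) := ⟨smul⟩

/-- The associated bilinear form `β(x, y) = q(x + y) - q(x) - q(y)`. -/
def beta (x y : LTerm m n LSort.V) : LTerm m n LSort.K := (x + y).q + -x.q + -y.q

/-- The linear combination `∑ aᵢ tᵢ`, where `a` are all the variables of sort `K`. -/
def linComb (t : Fin m → LTerm m n LSort.V) : LTerm m n LSort.V :=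
  (List.ofFn fun i => (fvar i : LTerm m n LSort.K) • t i).foldr (· + ·) 0

end LTerm

open LTerm LFormula

/-- The variables `v` of sort `V` are linearly independent (spelled out without `θ`). -/
def linIndep {k n : ℕ} (v : Fin k → Fin n) : LFormula 0 n :=
  allsK (m := k)
    ((eqV (linComb fun i => vvar (v i)) 0).imp (conj fun i : Fin k => eqK (fvar i) 0))

/-! ### Sentences about the field sort -/

/-- Ring terms as terms of the field sort. -/
def ofRingTerm {m : ℕ} : Language.ring.Term (Empty ⊕ Fin m) → LTerm m 0 LSort.K
  | .var (Sum.inl e) => e.elim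
  | .var (Sum.inr i) => fvar i
  | .func f ts => ringFun f fun i => ofRingTerm (ts i)

/-- Ring formulas as formulas about the field sort. -/
def ofRingFormula : {m : ℕ} → Language.ring.BoundedFormula Empty m → LFormula m 0
  | _, .falsum => falsum
  | _, .equal t₁ t₂ => eqK (ofRingTerm t₁) (ofRingTerm t₂)
  | _, .rel R _ => Empty.elim R
  | _, .imp φ ψ => (ofRingFormula φ).imp (ofRingFormula ψ)
  | _, .all φ => (ofRingFormula φ).allK

/-- The `L_O`-sentence saying that `K ⊨ φ`. -/
def fieldSentence (φ : Language.ring.Sentence) : LSentence := ofRingFormula φ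

/-- The set of `L_O`-sentences saying that `K ⊨ T`. -/
def fieldTheory (T : Language.ring.Theory) : Set LSentence := fieldSentence '' T

/-- `K` has exactly `c` elements. -/
def fieldCard (c : ℕ) : Set LSentence :=
  {fieldSentence (Language.Sentence.cardGe Language.ring c),
    (fieldSentence (Language.Sentence.cardGe Language.ring (c + 1))).not}

/-! ### The theory of orthogonal spaces in characteristic two -/

/-- `V` is an abelian group and a `K`-vector space under scalar multiplication. -/
def vectorSpaceAxioms : Set LSentence :=
  { univ (m := 0) (n := 3) (eqV (vvar 0 + vvar 1 + vvar 2) (vvar 0 + (vvar 1 + vvar 2))),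
    univ (m := 0) (n := 2) (eqV (vvar 0 + vvar 1) (vvar 1 + vvar 0)),
    univ (m := 0) (n := 1) (eqV (0 + vvar 0) (vvar 0)),
    univ (m := 0) (n := 1) (eqV (-vvar 0 + vvar 0) 0),
    univ (m := 0) (n := 1) (eqV ((1 : LTerm 0 1 LSort.K) • vvar 0) (vvar 0)),
    univ (m := 2) (n := 1)
      (eqV ((fvar 0 * fvar 1 : LTerm 2 1 LSort.K) • vvar 0)
        ((fvar 0 : LTerm 2 1 LSort.K) • (fvar 1 : LTerm 2 1 LSort.K) • vvar 0)),
    univ (m := 2) (n := 1)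
      (eqV ((fvar 0 + fvar 1 : LTerm 2 1 LSort.K) • vvar 0)
        ((fvar 0 : LTerm 2 1 LSort.K) • vvar 0 + (fvar 1 : LTerm 2 1 LSort.K) • vvar 0)),
    univ (m := 1) (n := 2)
      (eqV ((fvar 0 : LTerm 1 2 LSort.K) • (vvar 0 + vvar 1))
        ((fvar 0 : LTerm 1 2 LSort.K) • vvar 0 + (fvar 0 : LTerm 1 2 LSort.K) • vvar 1)) }

/-- `θ_{k+1}(v)` holds if and only if `v₀, …, v_k` are linearly independent. -/
def thetaAxiom (k : ℕ) : LSentence :=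
  univ (m := 0) (n := k + 1) ((theta k vvar).iff (linIndep id))

/-- If `v₀, …, v_k` are linearly independent and `w = ∑ aⱼ vⱼ`, then `π_{k+1,i}(v, w) = aᵢ`. -/
def coordAxiom (k : ℕ) (i : Fin (k + 1)) : LSentence :=
  univ (m := k + 1) (n := k + 2)
    (((theta k fun j => vvar j.castSucc).and
        (eqV (vvar (Fin.last (k + 1))) (linComb fun j => vvar j.castSucc))).imp
      (eqK (coord k i (fun j => vvar j.castSucc) (vvar (Fin.last (k + 1)))) (fvar i)))

/-- If `v₀, …, v_k` are not linearly independent or `w` is not in their span, then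
`π_{k+1,i}(v, w) = 0`. -/
def coordJunkAxiom (k : ℕ) (i : Fin (k + 1)) : LSentence :=
  univ (m := 0) (n := k + 2)
    (((theta k fun j => vvar j.castSucc).and
        (exsK (m := k + 1)
          (eqV (vvar (Fin.last (k + 1))) (linComb fun j => vvar j.castSucc)))).not.imp
      (eqK (coord k i (fun j => vvar j.castSucc) (vvar (Fin.last (k + 1)))) 0))

/-- `q` is a quadratic form whose associated form `β` is a non-degenerate symmetric bilinear
form. -/
def quadraticFormAxioms : Set LSentence :=
  { univ (m := 1) (n := 1)
      (eqK ((fvar 0 : LTerm 1 1 LSort.K) • vvar 0 : LTerm 1 1 LSort.V).q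
        (fvar 0 * fvar 0 * (vvar 0).q)),
    univ (m := 0) (n := 2) (eqK (beta (vvar 0) (vvar 1)) (beta (vvar 1) (vvar 0))),
    univ (m := 0) (n := 3)
      (eqK (beta (vvar 0 + vvar 1) (vvar 2))
        (beta (vvar 0) (vvar 2) + beta (vvar 1) (vvar 2))),
    univ (m := 1) (n := 2)
      (eqK (beta ((fvar 0 : LTerm 1 2 LSort.K) • vvar 0) (vvar 1))
        (fvar 0 * beta (vvar 0) (vvar 1))),
    univ (m := 0) (n := 1)
      ((allV (n := 1) (eqK (beta (vvar 0) (vvar 1)) 0)).imp (eqV (vvar 0) 0)) }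

/-- The theory `T⁰_O` of orthogonal spaces over fields of characteristic two. -/
def orthogonalTheory : Set LSentence :=
  fieldTheory Language.Theory.field ∪ {eqK (1 + 1) 0} ∪ vectorSpaceAxioms ∪
    Set.range thetaAxiom ∪ {φ | ∃ k i, φ = coordAxiom k i} ∪ {φ | ∃ k i, φ = coordJunkAxiom k i} ∪
    quadraticFormAxioms

/-- A pseudo-finite orthogonal space: an infinite orthogonal space `M` such that every sentence
true in `M` is true in some finite orthogonal space. -/
def IsPseudofinite (M : LStructure.{u}) : Prop :=
  M.IsModel orthogonalTheory ∧ (Infinite M.K ∨ Infinite M.V) ∧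
    ∀ φ : LSentence, M.Satisfies φ →
      ∃ N : LStructure.{u}, N.IsModel orthogonalTheory ∧ Finite N.K ∧ Finite N.V ∧ N.Satisfies φ

/-- `Th(M)` is axiomatized, modulo `T⁰_O`, by `Γ`: it is the set of consequences of
`T⁰_O ∪ Γ`. -/
def IsAxiomatizedBy (M : LStructure.{u}) (Γ : Set LSentence) : Prop :=
  M.completeTheory = {φ | Entails.{u} (orthogonalTheory ∪ Γ) φ}

/-! ### Dimension and Witt defect -/

/-- There are `d` linearly independent vectors. -/
def dimGE (d : ℕ) : LSentence := exsV (n := d) (linIndep id)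

/-- `dim V = d`. -/
def dimEq (d : ℕ) : Set LSentence := {dimGE d, (dimGE (d + 1)).not}

/-- `V` has infinite dimension. -/
def dimInfinite : Set LSentence := Set.range dimGE

/-- The Witt index is at least `r`: there are `r` linearly independent vectors that span a totally
singular subspace. -/
def wittIndexGE (r : ℕ) : LSentence :=
  exsV (n := r) ((linIndep id).and
    ((conj fun i : Fin r => eqK (vvar i).q 0).and
      (conj fun i : Fin r => conj fun j : Fin r => eqK (beta (vvar i) (vvar j)) 0)))

/-- For `dim V = 2n` and `e ≤ n`: the Witt defect is `e`, i.e. the Witt index, which is the largest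
dimension of a totally singular subspace, is `n - e`. -/
def wittDefectEq (n e : ℕ) : Set LSentence :=
  {wittIndexGE (n - e), (wittIndexGE (n - e + 1)).not}

/-! ### Pseudo-finite fields of characteristic two -/

/-- The theory `PSF₂` of pseudo-finite fields of characteristic two: its models are the infinite
models of the theory of all finite fields of characteristic two. -/
def PSF₂ : Language.ring.Theory :=
  {φ | ∀ (F : Type) [Field F] [Finite F] [CharP F 2] [Ring.CompatibleRing F], F ⊨ φ} ∪
    Language.ring.infiniteTheory

/-- `T` is a completion of `PSF₂`: a maximal consistent set of sentences containing `PSF₂`. -/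
def IsCompletionOfPSF₂ (T : Language.ring.Theory) : Prop :=
  T.IsMaximal ∧ PSF₂ ⊆ T

end OrthogonalSpaces

/-!
The vector space sort is eliminated uniformly in the field: the truth of an `L_O`-sentence in an
orthogonal space is expressed by a sentence in the language of rings about the field `K`.

* In dimension at least some `N` depending only on the sentence, over perfect fields of
  characteristic two, a single ring sentence works (`exists_sentence_of_large_rank`). Quantifiers
  over `V` are removed one at a time. The vectors in play lie in the span of a finite independent
  family and are described by their coordinates and the values of `q` and `β` on the family. A
  further vector is either in the span, hence given by coordinates, or it extends the family, hence
  is described by its values of `q` and `β`; by `exists_extension` all such values occur.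
* In dimension `2n` and Witt defect `e`, over perfect fields in which the additive group
  `{t² + t}` has index two (`IsGoodField`), again a single ring sentence works
  (`exists_sentence_of_rank_eq`). Splitting off hyperbolic planes leads to the form
  `∑ xᵢyᵢ + x_k² + dy_k²`, where only the class of `d` modulo `{t² + t}` matters, and this class is
  determined by the defect (`exists_isStandard_of_defect`). So the space is isometric to a space of
  coordinate vectors, which is interpreted in `K` (`formulaDef`).

Finite fields of characteristic two are good, as `t ↦ t² + t` is additive with kernel `{0, 1}`.
Goodness is a first-order property, hence passes to the models of `PSF₂` (`transfer_PSF₂`).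

Completeness of the listed axioms follows because a completion of `PSF₂`, or the cardinality of a
finite field, decides the ring sentences obtained. Pseudo-finiteness follows because a ring sentence
true in a model of `PSF₂` is true in a finite field of characteristic two (`exists_finite_field`),
over which there is a finite space of the same kind: one with the same dimension and defect, or a
hyperbolic space of large dimension. Conversely the field of a pseudo-finite space is finite or a
model of `PSF₂`, and a space over a good field has infinite dimension, or dimension `2n` and Witt
defect at most one (`IsGoodField.infinite_dim_or`).
-/

namespace OrthogonalSpaces

/-! ### Semantics of the derived connectives -/

section Connectives

variable {M : LStructure.{u}} {m n : ℕ} {a : Fin m → M.K} {v : Fin n → M.V}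

namespace LFormula

@[simp] theorem realize_eqK {s t : LTerm m n LSort.K} :
    (eqK s t).Realize M a v ↔ s.realize M a v = t.realize M a v := Iff.rfl

@[simp] theorem realize_eqV {s t : LTerm m n LSort.V} :
    (eqV s t).Realize M a v ↔ s.realize M a v = t.realize M a v := Iff.rfl

@[simp] theorem realize_theta {k : ℕ} {ts : Fin (k + 1) → LTerm m n LSort.V} :
    (theta k ts).Realize M a v ↔ M.theta k fun j => (ts j).realize M a v := Iff.rfl

@[simp] theorem realize_imp {φ ψ : LFormula m n} :
    (φ.imp ψ).Realize M a v ↔ (φ.Realize M a v → ψ.Realize M a v) := Iff.rfl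

@[simp] theorem realize_allK {φ : LFormula (m + 1) n} :
    φ.allK.Realize M a v ↔ ∀ x : M.K, φ.Realize M (Fin.snoc (α := fun _ => M.K) a x) v := Iff.rfl

@[simp] theorem realize_allV {φ : LFormula m (n + 1)} :
    φ.allV.Realize M a v ↔ ∀ x : M.V, φ.Realize M a (Fin.snoc (α := fun _ => M.V) v x) := Iff.rfl

@[simp] theorem realize_not {φ : LFormula m n} : φ.not.Realize M a v ↔ ¬ φ.Realize M a v := Iff.rfl

@[simp] theorem realize_top : (top : LFormula m n).Realize M a v := fun h => h

@[simp] theorem realize_and {φ ψ : LFormula m n} :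
    (φ.and ψ).Realize M a v ↔ φ.Realize M a v ∧ ψ.Realize M a v := by
  simp [LFormula.and]

@[simp] theorem realize_iff {φ ψ : LFormula m n} :
    (φ.iff ψ).Realize M a v ↔ (φ.Realize M a v ↔ ψ.Realize M a v) := by
  simp [LFormula.iff, iff_iff_implies_and_implies]

@[simp] theorem realize_exK {φ : LFormula (m + 1) n} :
    φ.exK.Realize M a v ↔ ∃ x : M.K, φ.Realize M (Fin.snoc (α := fun _ => M.K) a x) v := by
  simp [exK]

@[simp] theorem realize_exV {φ : LFormula m (n + 1)} :
    φ.exV.Realize M a v ↔ ∃ x : M.V, φ.Realize M a (Fin.snoc (α := fun _ => M.V) v x) := by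
  simp [exV]

@[simp] theorem realize_conj {k : ℕ} {φ : Fin k → LFormula m n} :
    (conj φ).Realize M a v ↔ ∀ i, (φ i).Realize M a v := by
  have aux (l : List (LFormula m n)) :
      (l.foldr LFormula.and top).Realize M a v ↔ ∀ ψ ∈ l, ψ.Realize M a v := by
    induction l with
    | nil => simp
    | cons ψ l ih => simp [ih]
  simp [conj, aux, List.mem_ofFn]

theorem forall_snoc {X : Type*} {k : ℕ} {P : (Fin (k + 1) → X) → Prop} :
    (∀ x, P x) ↔ ∀ (x : Fin k → X) (y : X), P (Fin.snoc (α := fun _ => X) x y) :=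
  ⟨fun h x y => h _, fun h x => by
    rw [← Fin.snoc_init_self (α := fun _ => X) x]
    exact h _ _⟩

theorem exists_snoc {X : Type*} {k : ℕ} {P : (Fin (k + 1) → X) → Prop} :
    (∃ x, P x) ↔ ∃ (x : Fin k → X) (y : X), P (Fin.snoc (α := fun _ => X) x y) := by
  have := forall_snoc (P := fun x => ¬ P x)
  simpa using not_congr this

@[simp] theorem realize_allsK {φ : LFormula m n} {b : Fin 0 → M.K} :
    φ.allsK.Realize M b v ↔ ∀ x : Fin m → M.K, φ.Realize M x v := by
  induction m with
  | zero => exact ⟨fun h x => Subsingleton.elim b x ▸ h, fun h => h b⟩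
  | succ m ih => rw [forall_snoc]; exact ih

@[simp] theorem realize_exsK {φ : LFormula m n} {b : Fin 0 → M.K} :
    φ.exsK.Realize M b v ↔ ∃ x : Fin m → M.K, φ.Realize M x v := by
  induction m with
  | zero => exact ⟨fun h => ⟨b, h⟩, fun ⟨x, h⟩ => Subsingleton.elim x b ▸ h⟩
  | succ m ih => rw [exists_snoc]; exact ih.trans (by simp)

@[simp] theorem realize_allsV {φ : LFormula m n} {b : Fin 0 → M.V} :
    φ.allsV.Realize M a b ↔ ∀ x : Fin n → M.V, φ.Realize M a x := by
  induction n with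
  | zero => exact ⟨fun h x => Subsingleton.elim b x ▸ h, fun h => h b⟩
  | succ m ih => rw [forall_snoc]; exact ih

@[simp] theorem realize_exsV {φ : LFormula m n} {b : Fin 0 → M.V} :
    φ.exsV.Realize M a b ↔ ∃ x : Fin n → M.V, φ.Realize M a x := by
  induction n with
  | zero => exact ⟨fun h => ⟨b, h⟩, fun ⟨x, h⟩ => Subsingleton.elim x b ▸ h⟩
  | succ m ih => rw [exists_snoc]; exact ih.trans (by simp)

theorem satisfies_univ {φ : LFormula m n} :
    M.Satisfies φ.univ ↔ ∀ (x : Fin n → M.V) (y : Fin m → M.K), φ.Realize M y x := by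
  simp [LStructure.Satisfies, LFormula.univ]

end LFormula

theorem realize_ofRingTerm {m : ℕ} (t : Language.ring.Term (Empty ⊕ Fin m)) (a : Fin m → M.K)
    (v : Fin 0 → M.V) :
    (ofRingTerm t).realize M a v = t.realize (Sum.elim (fun e : Empty => e.elim) a) := by
  induction t with
  | var x => rcases x with e | i
             · exact e.elim
             · rfl
  | func f ts ih =>
    simp only [ofRingTerm, LTerm.realize, Language.Term.realize]
    congr 1
    funext i
    exact ih i

theorem realize_ofRingFormula {m : ℕ} (φ : Language.ring.BoundedFormula Empty m) (a : Fin m → M.K)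
    (v : Fin 0 → M.V) :
    (ofRingFormula φ).Realize M a v ↔ φ.Realize (fun e : Empty => e.elim) a := by
  induction φ with
  | falsum => exact Iff.rfl
  | equal t₁ t₂ =>
    simp only [ofRingFormula, LFormula.realize_eqK, realize_ofRingTerm]
    exact Iff.rfl
  | rel R => exact Empty.elim R
  | imp φ ψ ih₁ ih₂ => exact imp_congr (ih₁ a) (ih₂ a)
  | all φ ih => exact forall_congr' fun x => ih _

theorem satisfies_fieldSentence (φ : Language.ring.Sentence) :
    M.Satisfies (fieldSentence φ) ↔ M.K ⊨ φ := by
  refine (realize_ofRingFormula φ _ _).trans ?_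
  simp only [Language.Sentence.Realize, Language.Formula.Realize]
  rw [Subsingleton.elim (fun e : Empty => e.elim : Empty → M.K) default,
    Subsingleton.elim (Fin.elim0 : Fin 0 → M.K) default]

theorem isModel_fieldTheory (T : Language.ring.Theory) :
    M.IsModel (fieldTheory T) ↔ M.K ⊨ T := by
  simp [LStructure.IsModel, fieldTheory, satisfies_fieldSentence, Language.Theory.model_iff]

theorem isModel_fieldCard (c : ℕ) : M.IsModel (fieldCard c) ↔ Cardinal.mk M.K = c := by
  have h1 : M.Satisfies (fieldSentence (Language.Sentence.cardGe Language.ring (c + 1))).not ↔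
      ¬ M.Satisfies (fieldSentence (Language.Sentence.cardGe Language.ring (c + 1))) := Iff.rfl
  simp only [LStructure.IsModel, fieldCard, Set.mem_insert_iff, Set.mem_singleton_iff,
    forall_eq_or_imp, forall_eq, h1, satisfies_fieldSentence, Language.Sentence.realize_cardGe]
  rw [Nat.cast_add_one, ← Cardinal.succ_natCast, Order.succ_le_iff, not_lt, and_comm,
    ← le_antisymm_iff]

theorem LStructure.isModel_union {Γ Δ : Set LSentence} :
    M.IsModel (Γ ∪ Δ) ↔ M.IsModel Γ ∧ M.IsModel Δ := by
  simp [LStructure.IsModel, or_imp, forall_and]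

theorem isModel_range {ι : Type*} {f : ι → LSentence} :
    M.IsModel (Set.range f) ↔ ∀ i, M.Satisfies (f i) := by
  simp [LStructure.IsModel]

end Connectives

/-! ### Structures on vector spaces -/

section ModuleStructure

variable (K V : Type u) [Field K] [AddCommGroup V] [Module K V]

/-- The `L_O`-structure on a vector space with arbitrary interpretations of `q`, `θ` and `π`. -/
@[reducible] def moduleStructure [Ring.CompatibleRing K] (q : V → K)
    (th : ∀ k, (Fin (k + 1) → V) → Prop)
    (co : ∀ k, Fin (k + 1) → (Fin (k + 1) → V) → V → K) : LStructure.{u} where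
  K := K
  V := V
  ringStructure := Ring.CompatibleRing.toStructure
  vzero := 0
  vadd := fun x y => x + y
  vneg := fun x => -x
  smul := fun c x => c • x
  q := q
  theta := th
  coord := co

variable {K V}

open Classical in
/-- The intended interpretation of `π`: the `i`-th coordinate of `w` with respect to `v` if `v` is
linearly independent and `w` is in its span, and `0` otherwise. -/
noncomputable def coordFun (k : ℕ) (i : Fin (k + 1)) (v : Fin (k + 1) → V) (w : V) : K :=
  if h : LinearIndependent K v ∧ ∃ a : Fin (k + 1) → K, w = ∑ j, a j • v j then h.2.choose i else 0

theorem eq_of_sum_smul_eq {ι : Type*} [Fintype ι] {v : ι → V} (hv : LinearIndependent K v)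
    {a b : ι → K} (h : ∑ j, a j • v j = ∑ j, b j • v j) : a = b := by
  have := Fintype.linearIndependent_iff.1 hv (fun j => a j - b j)
    (by simp [sub_smul, Finset.sum_sub_distrib, h])
  funext j
  exact sub_eq_zero.1 (this j)

theorem coordFun_eq_of_eq_sum {k : ℕ} {v : Fin (k + 1) → V} (hv : LinearIndependent K v)
    (a : Fin (k + 1) → K) {w : V} (hw : w = ∑ j, a j • v j) (i : Fin (k + 1)) :
    coordFun k i v w = a i := by
  have h : LinearIndependent K v ∧ ∃ a : Fin (k + 1) → K, w = ∑ j, a j • v j := ⟨hv, a, hw⟩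
  rw [coordFun, dif_pos h]
  exact congrFun (eq_of_sum_smul_eq hv (h.2.choose_spec.symm.trans hw)) i

theorem coordFun_eq_zero {k : ℕ} {v : Fin (k + 1) → V} {w : V}
    (h : ¬ (LinearIndependent K v ∧ ∃ a : Fin (k + 1) → K, w = ∑ j, a j • v j))
    (i : Fin (k + 1)) : (coordFun k i v w : K) = 0 := dif_neg h

theorem coordFun_eq_iff {k : ℕ} {v : Fin (k + 1) → V} {w : V} {i : Fin (k + 1)} {c : K} :
    coordFun k i v w = c ↔
      (LinearIndependent K v ∧ ∃ a : Fin (k + 1) → K, w = ∑ j, a j • v j ∧ a i = c) ∨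
      (¬ (LinearIndependent K v ∧ ∃ a : Fin (k + 1) → K, w = ∑ j, a j • v j) ∧ c = 0) := by
  by_cases h : LinearIndependent K v ∧ ∃ a : Fin (k + 1) → K, w = ∑ j, a j • v j
  · obtain ⟨hv, a, ha⟩ := h
    rw [coordFun_eq_of_eq_sum hv a ha]
    constructor
    · rintro rfl
      exact Or.inl ⟨hv, a, ha, rfl⟩
    · rintro (⟨-, b, hb, rfl⟩ | ⟨h, -⟩)
      · exact congrFun (eq_of_sum_smul_eq hv (ha.symm.trans hb)) i
      · exact absurd ⟨hv, a, ha⟩ h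
  · rw [coordFun_eq_zero h]
    constructor
    · rintro rfl
      exact Or.inr ⟨h, rfl⟩
    · rintro (⟨hv, b, hb, -⟩ | ⟨-, h⟩)
      · exact absurd ⟨hv, b, hb⟩ h
      · exact h.symm

variable [Ring.CompatibleRing K]

/-- The `L_O`-structure on a vector space with the intended interpretations of `θ` and `π`, for an
arbitrary function `q`. -/
@[reducible] noncomputable def orthStructure (q : V → K) : LStructure.{u} :=
  moduleStructure K V q (fun _ v => LinearIndependent K v) coordFun

variable {q : V → K} {th : ∀ k, (Fin (k + 1) → V) → Prop}
  {co : ∀ k, Fin (k + 1) → (Fin (k + 1) → V) → V → K} {m n : ℕ} {a : Fin m → K} {v : Fin n → V}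

local notation "S" => moduleStructure K V q th co

namespace LTerm

@[simp] theorem realize_addK (s t : LTerm m n LSort.K) :
    (s + t).realize S a v = (s.realize S a v + t.realize S a v : K) :=
  (Ring.CompatibleRing.funMap_add (R := K) _)

@[simp] theorem realize_mulK (s t : LTerm m n LSort.K) :
    (s * t).realize S a v = (s.realize S a v * t.realize S a v : K) :=
  (Ring.CompatibleRing.funMap_mul (R := K) _)

@[simp] theorem realize_negK (t : LTerm m n LSort.K) :
    (-t).realize S a v = (-t.realize S a v : K) :=
  (Ring.CompatibleRing.funMap_neg (R := K) _)

@[simp] theorem realize_zeroK :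
    (0 : LTerm m n LSort.K).realize S a v = (0 : K) :=
  (Ring.CompatibleRing.funMap_zero (R := K) _)

@[simp] theorem realize_oneK :
    (1 : LTerm m n LSort.K).realize S a v = (1 : K) :=
  (Ring.CompatibleRing.funMap_one (R := K) _)

@[simp] theorem realize_zeroV :
    (0 : LTerm m n LSort.V).realize S a v = (0 : V) := rfl

@[simp] theorem realize_addV (s t : LTerm m n LSort.V) :
    (s + t).realize S a v = (s.realize S a v + t.realize S a v : V) := rfl

@[simp] theorem realize_negV (t : LTerm m n LSort.V) :
    (-t).realize S a v = (-t.realize S a v : V) := rfl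

@[simp] theorem realize_smulV (c : LTerm m n LSort.K) (t : LTerm m n LSort.V) :
    (c • t).realize S a v = ((c.realize S a v : K) • t.realize S a v : V) := rfl

@[simp] theorem realize_fvar (i : Fin m) :
    (fvar i : LTerm m n LSort.K).realize S a v = a i := rfl

@[simp] theorem realize_vvar (i : Fin n) :
    (vvar i : LTerm m n LSort.V).realize S a v = v i := rfl

@[simp] theorem realize_q (t : LTerm m n LSort.V) :
    t.q.realize S a v = q (t.realize S a v) := rfl

@[simp] theorem realize_coord (k : ℕ) (i : Fin (k + 1)) (ts : Fin (k + 1) → LTerm m n LSort.V)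
    (w : LTerm m n LSort.V) :
    (coord k i ts w).realize S a v = co k i (fun j => (ts j).realize S a v) (w.realize S a v) := rfl

@[simp] theorem realize_beta (s t : LTerm m n LSort.V) :
    (beta s t).realize S a v =
      QuadraticMap.polar q (s.realize S a v) (t.realize S a v) := by
  simp [beta, QuadraticMap.polar, sub_eq_add_neg]

@[simp] theorem realize_linComb (t : Fin m → LTerm m n LSort.V) :
    (linComb t).realize S a v = (∑ i, a i • ((t i).realize S a v : V) : V) := by
  have aux (l : List (LTerm m n LSort.V)) : (l.foldr (· + ·) 0).realize S a v =
      ((l.map fun t => (t.realize S a v : V)).sum : V) := by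
    induction l with
    | nil => rfl
    | cons t l ih => simp [ih]
  rw [linComb, aux, List.map_ofFn, List.sum_ofFn]
  rfl

end LTerm

@[simp] theorem realize_linIndep {k : ℕ} {w : Fin k → Fin n} {b : Fin 0 → K} :
    (linIndep w).Realize S b v ↔ LinearIndependent K (fun i => v (w i)) := by
  simp [linIndep, Fintype.linearIndependent_iff]

end ModuleStructure

/-! ### Models of the theory of orthogonal spaces -/

/-- Non-degeneracy of the polar form of `q`. -/
def PolarNondegenerate {K V : Type*} [AddCommGroup K] [AddCommGroup V] (q : V → K) : Prop :=
  ∀ x : V, (∀ y, QuadraticMap.polar q x y = 0) → x = 0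

section

variable {K V : Type u} [Field K] [AddCommGroup V] [Module K V]

theorem exists_quadraticForm_iff {q : V → K} :
    (∃ Q : QuadraticForm K V, ⇑Q = q) ↔
      (∀ (x : V) (c : K), q (c • x) = c * c * q x) ∧
      (∀ x y z : V, QuadraticMap.polar q (x + y) z =
        QuadraticMap.polar q x z + QuadraticMap.polar q y z) ∧
      (∀ (x y : V) (c : K), QuadraticMap.polar q (c • x) y = c * QuadraticMap.polar q x y) := by
  constructor
  · rintro ⟨Q, rfl⟩
    exact ⟨fun x c => Q.map_smul c x, fun x y z => Q.polar_add_left x y z,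
      fun x y c => Q.polar_smul_left c x y⟩
  · rintro ⟨h1, h2, h3⟩
    exact ⟨QuadraticMap.ofPolar q (fun c x => h1 x c) h2 fun c x y => h3 x y c, rfl⟩

variable [Ring.CompatibleRing K]

/-- On a vector space the axioms say that the characteristic is two, that `θ` and `π` have their
intended interpretations, and that `q` is a non-degenerate quadratic form. -/
theorem moduleStructure_isModel_iff {q : V → K} {th : ∀ k, (Fin (k + 1) → V) → Prop}
    {co : ∀ k, Fin (k + 1) → (Fin (k + 1) → V) → V → K} :
    (moduleStructure K V q th co).IsModel orthogonalTheory ↔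
      (1 + 1 : K) = 0 ∧ moduleStructure K V q th co = orthStructure q ∧
      (∃ Q : QuadraticForm K V, ⇑Q = q) ∧ PolarNondegenerate q := by
  have hfield : (moduleStructure K V q th co).IsModel (fieldTheory Language.Theory.field) :=
    (isModel_fieldTheory _).2 (inferInstanceAs (K ⊨ Language.Theory.field))
  have h0 : (moduleStructure K V q th co).IsModel {LFormula.eqK (1 + 1) 0} ↔ (1 + 1 : K) = 0 := by
    simp [LStructure.IsModel, LStructure.Satisfies]
  have hvs : (moduleStructure K V q th co).IsModel vectorSpaceAxioms := by
    simp only [LStructure.IsModel, vectorSpaceAxioms, Set.mem_insert_iff, Set.mem_singleton_iff,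
      forall_eq_or_imp, forall_eq, LFormula.satisfies_univ]
    refine ⟨fun x _ => add_assoc _ _ _, fun x _ => add_comm _ _, ?_⟩
    simp [mul_smul, add_smul]
  have hth : (moduleStructure K V q th co).IsModel (Set.range thetaAxiom) ↔
      th = fun _ v => LinearIndependent K v := by
    rw [isModel_range]
    simp [thetaAxiom, LFormula.satisfies_univ, funext_iff]
  have hco : th = (fun _ v => LinearIndependent K v) →
      ((moduleStructure K V q th co).IsModel {φ | ∃ k i, φ = coordAxiom k i} ∧
      (moduleStructure K V q th co).IsModel {φ | ∃ k i, φ = coordJunkAxiom k i} ↔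
      co = coordFun) := by
    rintro rfl
    have h1 : (moduleStructure K V q (fun _ v => LinearIndependent K v) co).IsModel
        {φ | ∃ k i, φ = coordAxiom k i} ↔
        ∀ (k) (i : Fin (k + 1)) (x : Fin (k + 2) → V) (a : Fin (k + 1) → K),
        LinearIndependent K (fun j : Fin (k + 1) => x j.castSucc) →
        x (Fin.last (k + 1)) = ∑ j, a j • x (Fin.castSucc j) →
        co k i (fun j => x j.castSucc) (x (Fin.last (k + 1))) = a i := by
      simp only [LStructure.IsModel, Set.mem_ofPred_eq, forall_exists_index]
      rw [forall_comm]
      refine forall_congr' fun k => ?_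
      rw [forall_comm]
      refine forall_congr' fun i => ?_
      simp [coordAxiom, LFormula.satisfies_univ]
    have h2 : (moduleStructure K V q (fun _ v => LinearIndependent K v) co).IsModel
        {φ | ∃ k i, φ = coordJunkAxiom k i} ↔
        ∀ (k) (i : Fin (k + 1)) (x : Fin (k + 2) → V),
        ¬ (LinearIndependent K (fun j : Fin (k + 1) => x j.castSucc) ∧
          ∃ a : Fin (k + 1) → K, x (Fin.last (k + 1)) = ∑ j, a j • x (Fin.castSucc j)) →
        co k i (fun j => x j.castSucc) (x (Fin.last (k + 1))) = 0 := by
      simp only [LStructure.IsModel, Set.mem_ofPred_eq, forall_exists_index]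
      rw [forall_comm]
      refine forall_congr' fun k => ?_
      rw [forall_comm]
      refine forall_congr' fun i => ?_
      simp [coordJunkAxiom, LFormula.satisfies_univ]
    rw [h1, h2]
    constructor
    · rintro ⟨h1, h2⟩
      funext k i v w
      have e1 := h1 k i (Fin.snoc (α := fun _ => V) v w)
      have e2 := h2 k i (Fin.snoc (α := fun _ => V) v w)
      simp only [Fin.snoc_castSucc, Fin.snoc_last] at e1 e2
      by_cases h : LinearIndependent K v ∧ ∃ a : Fin (k + 1) → K, w = ∑ j, a j • v j
      · obtain ⟨hv, a, ha⟩ := h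
        rw [coordFun_eq_of_eq_sum hv a ha]
        exact e1 a hv ha
      · rw [coordFun_eq_zero h]
        exact e2 h
    · rintro rfl
      exact ⟨fun k i x a hx ha => coordFun_eq_of_eq_sum hx a ha i,
        fun k i x h => coordFun_eq_zero h i⟩
  have hq : (moduleStructure K V q th co).IsModel quadraticFormAxioms ↔
      (∃ Q : QuadraticForm K V, ⇑Q = q) ∧ PolarNondegenerate q := by
    rw [exists_quadraticForm_iff]
    simp only [LStructure.IsModel, quadraticFormAxioms, Set.mem_insert_iff, Set.mem_singleton_iff,
      forall_eq_or_imp, forall_eq, LFormula.satisfies_univ]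
    simp only [LFormula.forall_snoc (k := 0), LFormula.forall_snoc (k := 1),
      LFormula.forall_snoc (k := 2)]
    simp [Fin.snoc, PolarNondegenerate, and_assoc]
    exact fun _ _ _ _ => QuadraticMap.polar_comm q
  simp only [orthogonalTheory, LStructure.isModel_union, h0, hth, hq]
  constructor
  · rintro ⟨⟨⟨⟨⟨⟨-, h0⟩, -⟩, hth⟩, hc1⟩, hc2⟩, hq⟩
    refine ⟨h0, ?_, hq⟩
    have hc := (hco hth).1 ⟨hc1, hc2⟩
    subst hth hc
    rfl
  · rintro ⟨h0, h, hq⟩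
    have hth : th = fun _ v => LinearIndependent K v := by
      injection h
    have hc : co = coordFun := by
      injection h
    have := (hco hth).2 hc
    exact ⟨⟨⟨⟨⟨⟨hfield, h0⟩, hvs⟩, hth⟩, this.1⟩, this.2⟩, hq⟩

end

theorem LTerm.realize_mul_eq (M : LStructure.{u}) {m n : ℕ} (a : Fin m → M.K) (v : Fin n → M.V)
    (s t : LTerm m n LSort.K) : (s * t).realize M a v =
      Language.Structure.funMap Ring.mulFunc ![s.realize M a v, t.realize M a v] := by
  change Language.Structure.funMap _ _ = _
  congr 1
  funext i
  fin_cases i <;> rfl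

theorem LTerm.realize_add_eq (M : LStructure.{u}) {m n : ℕ} (a : Fin m → M.K) (v : Fin n → M.V)
    (s t : LTerm m n LSort.K) : (s + t).realize M a v =
      Language.Structure.funMap Ring.addFunc ![s.realize M a v, t.realize M a v] := by
  change Language.Structure.funMap _ _ = _
  congr 1
  funext i
  fin_cases i <;> rfl

/-- Every model of the theory of orthogonal spaces is the structure of a
non-degenerate quadratic form over a field of characteristic two. -/
theorem exists_eq_orthStructure {M : LStructure.{u}} (hM : M.IsModel orthogonalTheory) :
    ∃ (K V : Type u) (_ : Field K) (_ : Ring.CompatibleRing K) (_ : AddCommGroup V)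
      (_ : Module K V) (_ : CharP K 2) (Q : QuadraticForm K V),
      PolarNondegenerate Q ∧ M = orthStructure Q := by
  have hfield : M.K ⊨ Language.Theory.field := by
    rw [← isModel_fieldTheory]
    intro φ hφ
    exact hM φ (by simp [orthogonalTheory, hφ])
  have hvs : M.IsModel vectorSpaceAxioms := by
    intro φ hφ
    exact hM φ (by simp [orthogonalTheory, hφ])
  simp only [LStructure.IsModel, vectorSpaceAxioms, Set.mem_insert_iff, Set.mem_singleton_iff,
      forall_eq_or_imp, forall_eq, LFormula.satisfies_univ] at hvs
  obtain ⟨h1, h2, h3, h4, h5, h6', h7', h8⟩ := hvs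
  have h6 (c d : M.K) (x : M.V) :
      M.smul (Language.Structure.funMap Ring.mulFunc ![c, d]) x = M.smul c (M.smul d x) := by
    have h := h6' ![x] ![c, d]
    change M.smul (LTerm.realize M ![c, d] ![x] (LTerm.fvar 0 * LTerm.fvar 1)) x = _ at h
    rwa [LTerm.realize_mul_eq] at h
  have h7 (c d : M.K) (x : M.V) : M.smul (Language.Structure.funMap Ring.addFunc ![c, d]) x =
      M.vadd (M.smul c x) (M.smul d x) := by
    have h := h7' ![x] ![c, d]
    change M.smul (LTerm.realize M ![c, d] ![x] (LTerm.fvar 0 + LTerm.fvar 1)) x = _ at h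
    rwa [LTerm.realize_add_eq] at h
  clear h6' h7'
  obtain ⟨K, V, rs, z, ad, ng, sm, q, th, co⟩ := M
  let _ : Field K := FirstOrder.Field.fieldOfModelField K
  let _ : Ring.CompatibleRing K := FirstOrder.Field.compatibleRingOfModelField K
  let _ : AddCommGroup V :=
    { add := ad
      zero := z
      neg := ng
      add_assoc := fun x y w => h1 ![x, y, w] ![]
      add_comm := fun x y => h2 ![x, y] ![]
      zero_add := fun x => h3 ![x] ![]
      add_zero := fun x => (h2 ![x, z] ![]).trans (h3 ![x] ![])
      neg_add_cancel := fun x => h4 ![x] ![]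
      nsmul := @nsmulRec V ⟨z⟩ ⟨ad⟩
      zsmul := @zsmulRec V ⟨z⟩ ⟨ad⟩ ⟨ng⟩ (@nsmulRec V ⟨z⟩ ⟨ad⟩) }
  have e1 (x : Fin 0 → K) : Language.Structure.funMap Ring.oneFunc x = (1 : K) :=
    Ring.CompatibleRing.funMap_one x
  have e2 (x : Fin 2 → K) : Language.Structure.funMap Ring.mulFunc x = (x 0 * x 1 : K) :=
    Ring.CompatibleRing.funMap_mul x
  have e3 (x : Fin 2 → K) : Language.Structure.funMap Ring.addFunc x = (x 0 + x 1 : K) :=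
    Ring.CompatibleRing.funMap_add x
  have one_sm (x : V) : sm 1 x = x := by
    refine Eq.trans ?_ (h5 ![x] ![])
    exact congrArg (sm · x) (e1 _).symm
  have mul_sm (c d : K) (x : V) : sm (c * d) x = sm c (sm d x) := by
    exact (congrArg (sm · x) (e2 ![c, d])).symm.trans (h6 c d x)
  have add_sm (c d : K) (x : V) : sm (c + d) x = sm c x + sm d x := by
    exact (congrArg (sm · x) (e3 ![c, d])).symm.trans (h7 c d x)
  have sm_add (c : K) (x y : V) : sm c (x + y) = sm c x + sm c y := h8 ![x, y] ![c]
  have sm_zero (c : K) : sm c 0 = 0 := by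
    have := sm_add c 0 0
    rwa [add_zero, left_eq_add] at this
  have zero_sm (x : V) : sm 0 x = 0 := by
    have := add_sm 0 0 x
    rwa [add_zero, left_eq_add] at this
  let _ : Module K V :=
    { smul := sm
      one_smul := one_sm
      mul_smul := mul_sm
      add_smul := add_sm
      smul_add := sm_add
      smul_zero := sm_zero
      zero_smul := zero_sm }
  obtain ⟨h2, heq, ⟨Q, hQ⟩, hq⟩ := (moduleStructure_isModel_iff (K := K) (V := V) (q := q)
    (th := th) (co := co)).1 hM
  exact ⟨K, V, _, _, _, _, CharTwo.of_one_ne_zero_of_two_eq_zero one_ne_zero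
    (by rw [← one_add_one_eq_two, h2]), Q, hQ ▸ hq, by rw [hQ]; exact heq⟩

/-! ### Uniformly definable predicates on fields -/

/-- A predicate on tuples of field elements, given for all fields at once, is uniformly definable
if a single first-order formula in the language of rings defines it in every field. -/
def UDef {α : Type} (P : ∀ (K : Type u) [Field K] [Ring.CompatibleRing K], (α → K) → Prop) : Prop :=
  ∃ φ : Language.ring.Formula α, ∀ (K : Type u) [Field K] [Ring.CompatibleRing K] (v : α → K),
    φ.Realize v ↔ P K v

/-- A function on tuples of field elements is uniformly definable if its graph is. -/
def UFun {α : Type} (f : ∀ (K : Type u) [Field K] [Ring.CompatibleRing K], (α → K) → K) : Prop :=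
  UDef (α := α ⊕ Unit) fun K _ _ v => f K (fun i => v (Sum.inl i)) = v (Sum.inr ())

section UDef

variable {α β : Type}
  {P Q : ∀ (K : Type u) [Field K] [Ring.CompatibleRing K], (α → K) → Prop}
  {f g : ∀ (K : Type u) [Field K] [Ring.CompatibleRing K], (α → K) → K}

theorem UDef.congr (hP : UDef P)
    (h : ∀ (K : Type u) [Field K] [Ring.CompatibleRing K] (v : α → K), P K v ↔ Q K v) : UDef Q := by
  obtain ⟨φ, hφ⟩ := hP
  exact ⟨φ, fun K _ _ v => (hφ K v).trans (h K v)⟩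

theorem UDef.const (p : Prop) : UDef.{u} (α := α) fun _ _ _ _ => p := by
  by_cases hp : p
  · exact ⟨⊤, fun K _ _ v => by simp [hp]⟩
  · exact ⟨⊥, fun K _ _ v => by simp [hp]⟩

theorem UDef.not (hP : UDef P) : UDef fun K _ _ v => ¬ P K v := by
  obtain ⟨φ, hφ⟩ := hP
  exact ⟨φ.not, fun K _ _ v => by simp [hφ]⟩

theorem UDef.imp (hP : UDef P) (hQ : UDef Q) : UDef fun K _ _ v => P K v → Q K v := by
  obtain ⟨φ, hφ⟩ := hP
  obtain ⟨ψ, hψ⟩ := hQ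
  exact ⟨φ.imp ψ, fun K _ _ v => by simp [hφ, hψ]⟩

theorem UDef.and (hP : UDef P) (hQ : UDef Q) : UDef fun K _ _ v => P K v ∧ Q K v :=
  (hP.imp hQ.not).not.congr fun K _ _ v => by simp

theorem UDef.or (hP : UDef P) (hQ : UDef Q) : UDef fun K _ _ v => P K v ∨ Q K v :=
  (hP.not.imp hQ).congr fun K _ _ v => by tauto

theorem UDef.reindex (hP : UDef P) (e : α → β) : UDef fun K _ _ v => P K (fun i => v (e i)) := by
  obtain ⟨φ, hφ⟩ := hP
  exact ⟨φ.relabel e, fun K _ _ v => by rw [Language.Formula.realize_relabel, hφ]; rfl⟩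

theorem UDef.forall_index {ι : Type} [Finite ι]
    {P : ι → ∀ (K : Type u) [Field K] [Ring.CompatibleRing K], (α → K) → Prop}
    (hP : ∀ i, UDef (P i)) : UDef fun K _ _ v => ∀ i, P i K v := by
  choose φ hφ using hP
  exact ⟨Language.Formula.iInf φ, fun K _ _ v => by
    simp [Language.Formula.realize_iInf, hφ]⟩

/-- Quantification over a finite tuple of field elements. -/
theorem UDef.all [Finite β]
    {P : ∀ (K : Type u) [Field K] [Ring.CompatibleRing K], (α → K) → (β → K) → Prop}
    (hP : UDef (α := α ⊕ β) fun K _ _ v => P K (fun i => v (Sum.inl i)) (fun i => v (Sum.inr i))) :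
    UDef fun K _ _ v => ∀ w, P K v w := by
  obtain ⟨φ, hφ⟩ := hP
  exact ⟨φ.iAlls β, fun K _ _ v => by simp [Language.Formula.realize_iAlls, hφ]⟩

theorem UDef.all_sum [Finite β]
    {R : ∀ (K : Type u) [Field K] [Ring.CompatibleRing K], (α ⊕ β → K) → Prop} (hR : UDef R) :
    UDef fun K _ _ v => ∀ w : β → K, R K (Sum.elim v w) := by
  obtain ⟨φ, hφ⟩ := hR
  exact ⟨φ.iAlls β, fun K _ _ v => by simp [Language.Formula.realize_iAlls, hφ]⟩

theorem UDef.ex [Finite β]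
    {P : ∀ (K : Type u) [Field K] [Ring.CompatibleRing K], (α → K) → (β → K) → Prop}
    (hP : UDef (α := α ⊕ β) fun K _ _ v => P K (fun i => v (Sum.inl i)) (fun i => v (Sum.inr i))) :
    UDef fun K _ _ v => ∃ w, P K v w :=
  (UDef.all (P := fun K _ _ v w => ¬ P K v w) hP.not).not.congr fun K _ _ v => by simp

/-- Quantification over a single field element. -/
theorem UDef.all_one
    {P : ∀ (K : Type u) [Field K] [Ring.CompatibleRing K], (α → K) → K → Prop}
    (hP : UDef (α := α ⊕ Unit) fun K _ _ v => P K (fun i => v (Sum.inl i)) (v (Sum.inr ()))) :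
    UDef fun K _ _ v => ∀ c, P K v c :=
  (UDef.all (β := Unit) (P := fun K _ _ v w => P K v (w ())) hP).congr fun _ _ _ _ =>
    ⟨fun h c => h fun _ => c, fun h _ => h _⟩

theorem UDef.ex_one
    {P : ∀ (K : Type u) [Field K] [Ring.CompatibleRing K], (α → K) → K → Prop}
    (hP : UDef (α := α ⊕ Unit) fun K _ _ v => P K (fun i => v (Sum.inl i)) (v (Sum.inr ()))) :
    UDef fun K _ _ v => ∃ c, P K v c :=
  (UDef.all_one (P := fun K _ _ v w => ¬ P K v w) hP.not).not.congr fun K _ _ v => by simp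

/-- Substitution of uniformly definable functions. -/
theorem UDef.comp [Finite β] (hP : UDef P)
    {f : α → ∀ (K : Type u) [Field K] [Ring.CompatibleRing K], (β → K) → K} [Finite α]
    (hf : ∀ i, UFun (f i)) : UDef fun K _ _ v => P K (fun i => f i K v) := by
  have h : UDef fun K _ _ (v : β → K) => ∀ w : α → K, (∀ i, f i K v = w i) → P K w := by
    refine UDef.all (P := fun K _ _ v w => (∀ i, f i K v = w i) → P K w) (UDef.imp ?_ ?_)
    · exact UDef.forall_index fun i =>
        (hf i).reindex (Sum.elim Sum.inl fun _ => Sum.inr i : β ⊕ Unit → β ⊕ α)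
    · exact hP.reindex _
  refine h.congr fun K _ _ v => ⟨fun h => h _ fun _ => rfl, fun h w hw => ?_⟩
  rw [← funext hw]
  exact h

theorem UFun.congr (hf : UFun f)
    (h : ∀ (K : Type u) [Field K] [Ring.CompatibleRing K] (v : α → K), f K v = g K v) : UFun g :=
  UDef.congr hf fun K _ _ v => by rw [h]

theorem UFun.reindex (hf : UFun f) (e : α → β) : UFun fun K _ _ v => f K (fun i => v (e i)) :=
  UDef.reindex hf (Sum.map e id)

theorem UFun.var (i : α) : UFun.{u} (fun _ _ _ v => v i) :=
  ⟨Language.Term.equal (Language.Term.var (Sum.inl i)) (Language.Term.var (Sum.inr ())),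
    fun K _ _ v => by simp⟩

theorem UFun.of_term (t : Language.ring.Term α)
    (h : ∀ (K : Type u) [Field K] [Ring.CompatibleRing K] (v : α → K), t.realize v = f K v) :
    UFun f :=
  ⟨Language.Term.equal (t.relabel Sum.inl) (Language.Term.var (Sum.inr ())),
    fun K _ _ v => by simp [h, Function.comp_def]⟩

theorem UFun.zero : UFun.{u} (α := α) (fun _ _ _ _ => 0) := UFun.of_term 0 fun K _ _ v => by simp

theorem UFun.one : UFun.{u} (α := α) (fun _ _ _ _ => 1) := UFun.of_term 1 fun K _ _ v => by simp

variable [Finite α]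

theorem UFun.comp [Finite β] (hf : UFun f)
    {g : α → ∀ (K : Type u) [Field K] [Ring.CompatibleRing K], (β → K) → K}
    (hg : ∀ i, UFun (g i)) : UFun fun K _ _ v => f K (fun i => g i K v) := by
  refine (UDef.comp (β := β ⊕ Unit) hf (f := Sum.elim
    (fun i K _ _ v => g i K (fun j => v (Sum.inl j))) (fun _ K _ _ v => v (Sum.inr ()))) ?_).congr
    fun K _ _ v => Iff.rfl
  rintro (i | i)
  · exact (hg i).reindex _
  · exact UFun.var _

theorem UDef.eq (hf : UFun f) (hg : UFun g) : UDef fun K _ _ v => f K v = g K v := by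
  refine (UDef.comp (β := α) hf (f := Sum.elim (fun i K _ _ v => v i) fun _ => g) ?_).congr
    fun K _ _ v => Iff.rfl
  rintro (i | i)
  · exact UFun.var _
  · exact hg

theorem UFun.add (hf : UFun f) (hg : UFun g) : UFun fun K _ _ v => f K v + g K v := by
  have h : UFun.{u} (α := Bool) fun K _ _ v => v false + v true :=
    UFun.of_term (Language.Term.var false + Language.Term.var true) fun K _ _ v => by simp
  exact h.comp (g := fun b => bif b then g else f) (by rintro (_ | _) <;> assumption)

theorem UFun.mul (hf : UFun f) (hg : UFun g) : UFun fun K _ _ v => f K v * g K v := by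
  have h : UFun.{u} (α := Bool) fun K _ _ v => v false * v true :=
    UFun.of_term (Language.Term.var false * Language.Term.var true) fun K _ _ v => by simp
  exact h.comp (g := fun b => bif b then g else f) (by rintro (_ | _) <;> assumption)

theorem UFun.neg (hf : UFun f) : UFun fun K _ _ v => - f K v := by
  have h : UFun.{u} (α := Unit) fun K _ _ v => - v () :=
    UFun.of_term (-Language.Term.var ()) fun K _ _ v => by simp
  exact h.comp (g := fun _ => f) fun _ => hf

theorem UFun.sum {ι : Type} [Fintype ι]
    {f : ι → ∀ (K : Type u) [Field K] [Ring.CompatibleRing K], (α → K) → K}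
    (hf : ∀ i, UFun (f i)) : UFun fun K _ _ v => ∑ i, f i K v := by
  classical
  have (s : Finset ι) : UFun fun K _ _ v => ∑ i ∈ s, f i K v := by
    induction s using Finset.induction_on with
    | empty => exact UFun.zero.congr fun K _ _ v => by simp
    | insert i s hi ih => exact ((hf i).add ih).congr fun K _ _ v => by rw [Finset.sum_insert hi]
  exact this _

end UDef

/-- A uniformly definable predicate without parameters is given by a sentence. -/
theorem UDef.exists_sentence
    {P : ∀ (K : Type u) [Field K] [Ring.CompatibleRing K], Prop}
    (hP : UDef (α := Empty) fun K _ _ _ => P K) :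
    ∃ ψ : Language.ring.Sentence,
      ∀ (K : Type u) [Field K] [Ring.CompatibleRing K], K ⊨ ψ ↔ P K := by
  obtain ⟨φ, hφ⟩ := hP
  exact ⟨φ, fun K _ _ => hφ K _⟩

/-! ### Linear isometries preserve the values of terms -/

section Isometry

variable {K V W : Type u} [Field K] [AddCommGroup V] [Module K V] [AddCommGroup W] [Module K W]
  {q : V → K} {q' : W → K} {m n : ℕ}

theorem coordFun_map (f : V →ₗ[K] W) (hf : Function.Injective f) {k : ℕ} (i : Fin (k + 1))
    (v : Fin (k + 1) → V) (w : V) :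
    (coordFun k i (fun j => f (v j)) (f w) : K) = coordFun k i v w := by
  have h1 : LinearIndependent K (fun j => f (v j)) ↔ LinearIndependent K v :=
    f.linearIndependent_iff (LinearMap.ker_eq_bot.2 hf)
  have h2 (a : Fin (k + 1) → K) : f w = ∑ j, a j • f (v j) ↔ w = ∑ j, a j • v j := by
    rw [← hf.eq_iff]
    simp
  rw [coordFun_eq_iff]
  simp only [h1, h2]
  exact coordFun_eq_iff.1 rfl

variable [Ring.CompatibleRing K]

/-- The map induced by `f : V → W` on the carriers of both sorts; it is the identity on `K`. -/
def sortMap (q : V → K) (q' : W → K) (f : V → W) :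
    (s : LSort) → (orthStructure q).carrier s → (orthStructure q').carrier s
  | LSort.K, x => x
  | LSort.V, x => f x

theorem LTerm.realize_map (f : V →ₗ[K] W) (hf : Function.Injective f) (hq : ∀ x, q' (f x) = q x)
    {s : LSort} (t : LTerm m n s) (a : Fin m → K) (v : Fin n → V) :
    t.realize (orthStructure q') a (fun i => f (v i)) =
      sortMap q q' f s (t.realize (orthStructure q) a v) := by
  induction t with
  | fvar i => rfl
  | vvar i => rfl
  | ringFun g ts ih => exact congrArg (Language.Structure.funMap (M := K) g) (funext ih)
  | vzero => exact (map_zero f).symm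
  | vadd t₁ t₂ ih₁ ih₂ =>
    exact (congrArg₂ (fun x y : W => x + y) ih₁ ih₂).trans (map_add f _ _).symm
  | vneg t ih => exact (congrArg (fun x : W => -x) ih).trans (map_neg f _).symm
  | smul c t ih₁ ih₂ =>
    exact (congrArg₂ (fun (x : K) (y : W) => x • y) ih₁ ih₂).trans (map_smul f _ _).symm
  | q t ih => exact (congrArg q' ih).trans (hq _)
  | coord k i ts w ih₁ ih₂ =>
    exact (congrArg₂ (coordFun k i) (funext ih₁) ih₂).trans (coordFun_map f hf i _ _)

/-- Surjective linear isometries preserve the truth of formulas. -/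
theorem LFormula.realize_map (f : V ≃ₗ[K] W) (hq : ∀ x, q' (f x) = q x)
    (φ : LFormula m n) (a : Fin m → K) (v : Fin n → V) :
    φ.Realize (orthStructure q') a (fun i => f (v i)) ↔ φ.Realize (orthStructure q) a v := by
  have ht {m n : ℕ} {s : LSort} (t : LTerm m n s) (a : Fin m → K) (v : Fin n → V) :
      t.realize (orthStructure q') a (fun i => f (v i)) =
        sortMap q q' f s (t.realize (orthStructure q) a v) :=
    LTerm.realize_map f.toLinearMap f.injective hq t a v
  induction φ with
  | falsum => exact Iff.rfl
  | eqK t₁ t₂ => simp only [LFormula.realize_eqK, ht, sortMap]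
  | eqV t₁ t₂ => simp only [LFormula.realize_eqV, ht, sortMap, EmbeddingLike.apply_eq_iff_eq]
  | theta k ts =>
    simp only [LFormula.realize_theta, ht, sortMap]
    exact f.toLinearMap.linearIndependent_iff f.ker
  | imp φ ψ ih₁ ih₂ => exact imp_congr (ih₁ a v) (ih₂ a v)
  | allK φ ih => exact forall_congr' fun x => ih _ v
  | allV φ ih =>
    simp only [LFormula.realize_allV]
    rw [f.toEquiv.surjective.forall]
    refine forall_congr' fun x => ?_
    refine Iff.trans (iff_of_eq (congrArg _ ?_)) (ih a (Fin.snoc (α := fun _ => V) v x))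
    funext i
    refine Fin.lastCases ?_ (fun i => ?_) i <;> simp

end Isometry

/-! ### Definability in coordinate spaces -/

section Definability

variable {ι π : Type} [Fintype ι] [Finite π]
  {q : ∀ (K : Type u) [Field K] [Ring.CompatibleRing K], (π → K) → (ι → K) → K} {m n : ℕ}

/-- The variables needed to describe `m` field elements, `n` vectors of `K^ι`, and the parameters
`π` of a quadratic form on `K^ι`. -/
abbrev Ctx (m n : ℕ) (ι π : Type) : Type := (Fin m ⊕ Fin n × ι) ⊕ π

/-- Uniform definability of the value of a term in the structure on `K^ι` given by `q`. -/
def TermDef (q : ∀ (K : Type u) [Field K] [Ring.CompatibleRing K], (π → K) → (ι → K) → K) :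
    (s : LSort) → LTerm m n s → Prop
  | LSort.K, t => UFun (α := Ctx m n ι π) fun K _ _ v =>
      t.realize (orthStructure (q K fun i => v (Sum.inr i))) (fun i => v (Sum.inl (Sum.inl i)))
        (fun j i => v (Sum.inl (Sum.inr (j, i))))
  | LSort.V, t => ∀ i : ι, UFun (α := Ctx m n ι π) fun K _ _ v =>
      (t.realize (orthStructure (q K fun i => v (Sum.inr i))) (fun i => v (Sum.inl (Sum.inl i)))
        (fun j i => v (Sum.inl (Sum.inr (j, i)))) : ι → K) i

theorem udef_linearIndependent (k : ℕ) :
    UDef.{u} (α := Fin k × ι) fun K _ _ v => LinearIndependent K fun j i => v (j, i) := by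
  have h : UDef.{u} (α := Fin k × ι) fun K _ _ v => ∀ a : Fin k → K,
      (∀ i, ∑ j, a j * v (j, i) = 0) → ∀ j, a j = 0 := by
    refine UDef.all (P := fun K _ _ v a => (∀ i, ∑ j, a j * v (j, i) = 0) → ∀ j, a j = 0)
      (UDef.imp ?_ ?_)
    · exact UDef.forall_index fun i => UDef.eq
        (UFun.sum fun j => (UFun.var (Sum.inr j)).mul (UFun.var (Sum.inl (j, i)))) UFun.zero
    · exact UDef.forall_index fun j => UDef.eq (UFun.var (Sum.inr j)) UFun.zero
  refine h.congr fun K _ _ v => ?_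
  simp [Fintype.linearIndependent_iff, funext_iff, Finset.sum_apply]

theorem ufun_coordFun (k : ℕ) (i : Fin (k + 1)) :
    UFun.{u} (α := Fin (k + 1) × ι ⊕ ι) fun _ _ _ v =>
      coordFun k i (fun j i => v (Sum.inl (j, i))) (fun i => v (Sum.inr i)) := by
  have hsum : UDef.{u} (α := ((Fin (k + 1) × ι ⊕ ι) ⊕ Unit) ⊕ Fin (k + 1)) fun K _ _ v =>
      ∀ l, v (Sum.inl (Sum.inl (Sum.inr l))) =
        ∑ j, v (Sum.inr j) * v (Sum.inl (Sum.inl (Sum.inl (j, l)))) :=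
    UDef.forall_index fun l => UDef.eq (UFun.var _)
      (UFun.sum fun j => (UFun.var (Sum.inr j)).mul (UFun.var _))
  have hli : UDef.{u} (α := (Fin (k + 1) × ι ⊕ ι) ⊕ Unit) fun K _ _ v =>
      LinearIndependent K fun (j : Fin (k + 1)) (i : ι) => v (Sum.inl (Sum.inl (j, i))) :=
    (udef_linearIndependent (k + 1)).reindex fun p => Sum.inl (Sum.inl p)
  have h : UDef.{u} (α := (Fin (k + 1) × ι ⊕ ι) ⊕ Unit) fun K _ _ v =>
      (LinearIndependent K (fun (j : Fin (k + 1)) (i : ι) => v (Sum.inl (Sum.inl (j, i)))) ∧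
        ∃ a : Fin (k + 1) → K, (∀ l, v (Sum.inl (Sum.inr l)) =
          ∑ j, a j * v (Sum.inl (Sum.inl (j, l)))) ∧ a i = v (Sum.inr ())) ∨
      (¬ (LinearIndependent K (fun (j : Fin (k + 1)) (i : ι) => v (Sum.inl (Sum.inl (j, i)))) ∧
        ∃ a : Fin (k + 1) → K, (∀ l, v (Sum.inl (Sum.inr l)) =
          ∑ j, a j * v (Sum.inl (Sum.inl (j, l))))) ∧ v (Sum.inr ()) = 0) := by
    refine UDef.or (hli.and (UDef.ex (P := fun K _ _ v a => (∀ l, v (Sum.inl (Sum.inr l)) =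
          ∑ j, a j * v (Sum.inl (Sum.inl (j, l)))) ∧ a i = v (Sum.inr ())) (hsum.and ?_)))
      ((hli.and (UDef.ex (P := fun K _ _ v a => (∀ l, v (Sum.inl (Sum.inr l)) =
          ∑ j, a j * v (Sum.inl (Sum.inl (j, l))))) hsum)).not.and ?_)
    · exact UDef.eq (UFun.var _) (UFun.var _)
    · exact UDef.eq (UFun.var _) UFun.zero
  refine h.congr fun K _ _ v => ?_
  rw [coordFun_eq_iff]
  simp [funext_iff, Finset.sum_apply]

theorem termDef (hq : UFun (α := π ⊕ ι) fun K _ _ v =>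
      q K (fun i => v (Sum.inl i)) (fun i => v (Sum.inr i)))
    {s : LSort} (t : LTerm m n s) : TermDef q s t := by
  induction t with
  | fvar i => exact UFun.var _
  | vvar j => exact fun i => UFun.var (Sum.inl (Sum.inr (j, i)))
  | @ringFun k f ts ih =>
    have h : UFun.{u} (α := Fin k) fun K _ _ v => Language.Structure.funMap f v :=
      UFun.of_term (Language.Term.func f Language.Term.var) fun _ _ _ _ => rfl
    exact h.comp (g := fun j K _ _ v => (ts j).realize (orthStructure (q K fun i => v (Sum.inr i)))
      (fun i => v (Sum.inl (Sum.inl i))) (fun j i => v (Sum.inl (Sum.inr (j, i))))) ih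
  | vzero => exact fun i => UFun.zero
  | vadd t₁ t₂ ih₁ ih₂ => exact fun i => (ih₁ i).add (ih₂ i)
  | vneg t ih => exact fun i => (ih i).neg
  | smul c t ih₁ ih₂ => exact fun i => UFun.mul ih₁ (ih₂ i)
  | q t ih =>
    refine hq.comp (g := Sum.elim (fun i K _ _ v => v (Sum.inr i)) fun i K _ _ v =>
      (t.realize (orthStructure (q K fun i => v (Sum.inr i))) (fun i => v (Sum.inl (Sum.inl i)))
        (fun j i => v (Sum.inl (Sum.inr (j, i)))) : ι → K) i) ?_
    rintro (i | i)
    · exact UFun.var _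
    · exact ih i
  | coord k i ts w ih₁ ih₂ =>
    refine (ufun_coordFun k i).comp (g := Sum.elim (fun p K _ _ v =>
      ((ts p.1).realize (orthStructure (q K fun i => v (Sum.inr i)))
        (fun i => v (Sum.inl (Sum.inl i)))
        (fun j i => v (Sum.inl (Sum.inr (j, i)))) : ι → K) p.2) fun i K _ _ v =>
      (w.realize (orthStructure (q K fun i => v (Sum.inr i))) (fun i => v (Sum.inl (Sum.inl i)))
        (fun j i => v (Sum.inl (Sum.inr (j, i)))) : ι → K) i) ?_
    rintro (i | i)
    · exact ih₁ _ _
    · exact ih₂ _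

/-- Uniform definability of the truth of a formula in the structure on `K^ι` given by `q`. -/
def FormulaDef (q : ∀ (K : Type u) [Field K] [Ring.CompatibleRing K], (π → K) → (ι → K) → K)
    (φ : LFormula m n) : Prop :=
  UDef (α := Ctx m n ι π) fun K _ _ v =>
    φ.Realize (orthStructure (q K fun i => v (Sum.inr i))) (fun i => v (Sum.inl (Sum.inl i)))
        (fun j i => v (Sum.inl (Sum.inr (j, i))))

theorem formulaDef_eqK (hq : UFun (α := π ⊕ ι) fun K _ _ v =>
      q K (fun i => v (Sum.inl i)) (fun i => v (Sum.inr i)))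
    (t₁ t₂ : LTerm m n LSort.K) : FormulaDef q (.eqK t₁ t₂) :=
  UDef.eq (termDef hq t₁) (termDef hq t₂)

theorem formulaDef_eqV (hq : UFun (α := π ⊕ ι) fun K _ _ v =>
      q K (fun i => v (Sum.inl i)) (fun i => v (Sum.inr i)))
    (t₁ t₂ : LTerm m n LSort.V) : FormulaDef q (.eqV t₁ t₂) :=
  (UDef.forall_index fun i => UDef.eq (termDef hq t₁ i) (termDef hq t₂ i)).congr
    fun _ _ _ _ => funext_iff.symm

theorem formulaDef_theta (hq : UFun (α := π ⊕ ι) fun K _ _ v =>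
      q K (fun i => v (Sum.inl i)) (fun i => v (Sum.inr i)))
    (k : ℕ) (ts : Fin (k + 1) → LTerm m n LSort.V) :
    FormulaDef q (.theta k ts) :=
  (udef_linearIndependent (k + 1)).comp
    (f := fun p K _ _ v => ((ts p.1).realize (orthStructure (q K fun i => v (Sum.inr i)))
        (fun i => v (Sum.inl (Sum.inl i)))
        (fun j i => v (Sum.inl (Sum.inr (j, i)))) : ι → K) p.2) fun p => termDef hq (ts p.1) p.2

/-- In the structures on `K^ι` given by a uniformly definable `q`, truth of an `L_O`-formula is
uniformly definable in the field `K`. -/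
theorem formulaDef (hq : UFun (α := π ⊕ ι) fun K _ _ v =>
      q K (fun i => v (Sum.inl i)) (fun i => v (Sum.inr i)))
    (φ : LFormula m n) : FormulaDef q φ := by
  induction φ with
  | falsum => exact UDef.const False
  | eqK t₁ t₂ => exact formulaDef_eqK hq t₁ t₂
  | eqV t₁ t₂ => exact formulaDef_eqV hq t₁ t₂
  | theta k ts => exact formulaDef_theta hq k ts
  | imp φ ψ ih₁ ih₂ => exact UDef.imp ih₁ ih₂
  | @allK m n φ ih =>
    let e : Ctx (m + 1) n ι π → Ctx m n ι π ⊕ Unit :=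
      Sum.elim (Sum.elim (Fin.lastCases (Sum.inr ()) fun i => Sum.inl (Sum.inl (Sum.inl i)))
        fun p => Sum.inl (Sum.inl (Sum.inr p))) fun i => Sum.inl (Sum.inr i)
    refine UDef.all_one (P := fun K _ _ v c =>
      φ.Realize (orthStructure (q K fun i => v (Sum.inr i)))
        (Fin.snoc (α := fun _ => K) (fun i => v (Sum.inl (Sum.inl i))) c)
        (fun j i => v (Sum.inl (Sum.inr (j, i))))) ((UDef.reindex ih e).congr fun K _ _ v => ?_)
    refine iff_of_eq (congrArg₂ _ ?_ rfl)
    funext i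
    refine Fin.lastCases ?_ (fun i => ?_) i <;> simp [e]
  | @allV m n φ ih =>
    let e : Ctx m (n + 1) ι π → Ctx m n ι π ⊕ ι :=
      Sum.elim (Sum.elim (fun i => Sum.inl (Sum.inl (Sum.inl i)))
        fun p => Fin.lastCases (Sum.inr p.2) (fun j => Sum.inl (Sum.inl (Sum.inr (j, p.2)))) p.1)
        fun i => Sum.inl (Sum.inr i)
    refine UDef.all (β := ι) (P := fun K _ _ v c =>
      φ.Realize (orthStructure (q K fun i => v (Sum.inr i)))
        (fun i => v (Sum.inl (Sum.inl i)))
        (Fin.snoc (α := fun _ => ι → K) (fun j i => v (Sum.inl (Sum.inr (j, i)))) c))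
        ((UDef.reindex ih e).congr fun K _ _ v => ?_)
    refine iff_of_eq (congrArg _ ?_)
    funext j i
    refine Fin.lastCases ?_ (fun j => ?_) j <;> simp [e]

end Definability

/-! ### Vectors with prescribed values of the forms -/

section Geometry

variable {K V : Type u} [Field K] [AddCommGroup V] [Module K V] {Q : QuadraticForm K V}
  {κ : Type} [Fintype κ]

open QuadraticMap in
/-- Against a linearly independent family, the polar form takes arbitrary values. -/
theorem exists_polar_eq (hQ : PolarNondegenerate Q) {e : κ → V} (he : LinearIndependent K e)
    (b : κ → K) : ∃ w, ∀ i, polar Q (e i) w = b i := by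
  classical
  let T : V →ₗ[K] (κ → K) := LinearMap.pi fun i => Q.polarBilin (e i)
  suffices h : LinearMap.range T = ⊤ by
    obtain ⟨w, hw⟩ := LinearMap.range_eq_top.1 h b
    exact ⟨w, fun i => congrFun hw i⟩
  by_contra h
  -- A functional vanishing on the range gives a linear combination of `e` in the radical.
  obtain ⟨f, hf, hle⟩ := Submodule.exists_le_ker_of_lt_top _ (lt_top_iff_ne_top.2 h)
  have hf' (x : κ → K) : f x = ∑ i, f (Pi.single i 1) * x i := by
    conv_lhs => rw [pi_eq_sum_univ' x]
    simp [map_sum, mul_comm]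
  have h0 : ∑ i, f (Pi.single i 1) • e i = 0 := by
    refine hQ _ fun w => ?_
    have h1 : f (T w) = 0 := hle ⟨w, rfl⟩
    rw [hf'] at h1
    have h2 := (map_sum Q.polarBilin (fun i => f (Pi.single i 1) • e i) Finset.univ)
    have h3 := LinearMap.congr_fun h2 w
    simp only [LinearMap.sum_apply, map_smul, LinearMap.smul_apply, polarBilin_apply_apply,
      smul_eq_mul] at h3
    exact h3.trans h1
  have h1 := Fintype.linearIndependent_iff.1 he _ h0
  exact hf (LinearMap.ext fun x => by rw [hf']; simp [h1])

open QuadraticMap in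
/-- The orthogonal complement of a small family is not contained in a small subspace. -/
theorem exists_orthogonal_notMem (e : κ → V) (S : Submodule K V)
    (h : (Fintype.card κ : Cardinal) + Module.rank K S < Module.rank K V) :
    ∃ x, x ∉ S ∧ ∀ i, polar Q (e i) x = 0 := by
  by_contra! hx
  let T : V →ₗ[K] (κ → K) := LinearMap.pi fun i => Q.polarBilin (e i)
  have hker : LinearMap.ker T ≤ S := by
    intro x hxT
    by_contra hxS
    obtain ⟨i, hi⟩ := hx x hxS
    exact hi (congrFun (LinearMap.mem_ker.1 hxT) i)
  refine h.not_ge ?_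
  rw [← LinearMap.rank_range_add_rank_ker T]
  refine add_le_add ?_ (Submodule.rank_mono hker)
  refine (Submodule.rank_le _).trans ?_
  rw [rank_fun']

theorem rank_span_range_le (e : κ → V) :
    Module.rank K (Submodule.span K (Set.range e)) ≤ Fintype.card κ := by
  have : Module.Finite K (Submodule.span K (Set.range e)) :=
    Module.Finite.span_of_finite K (Set.finite_range e)
  rw [← Module.finrank_eq_rank, Nat.cast_le]
  exact finrank_range_le_card e

open QuadraticMap in
/-- In a space of large dimension over a perfect field of characteristic two, a linearly independent
family can be extended by a vector with arbitrary prescribed values of `q` and of `β`. -/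
theorem exists_extension [CharP K 2] (hsq : ∀ c : K, ∃ y, y * y = c)
    (hQ : PolarNondegenerate Q) {e : κ → V} (he : LinearIndependent K e)
    (hr : ((2 * Fintype.card κ + 5 : ℕ) : Cardinal) ≤ Module.rank K V) (b : κ → K) (s : K) :
    ∃ w, w ∉ Submodule.span K (Set.range e) ∧ (∀ i, polar Q (e i) w = b i) ∧ Q w = s := by
  have hlt {m : ℕ} {S : Submodule K V} {l : ℕ} (hS : Module.rank K S ≤ (m : Cardinal))
      (h : l + m < 2 * Fintype.card κ + 5) : (l : Cardinal) + Module.rank K S < Module.rank K V :=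
    (add_le_add le_rfl hS).trans_lt ((by exact_mod_cast h :
      (l : Cardinal) + m < ((2 * Fintype.card κ + 5 : ℕ) : Cardinal)).trans_le hr)
  -- A vector `w` with `β(x, w) ≠ 0` for some `x` orthogonal to `e` is not in the span of `e`.
  obtain ⟨x, hx, hex⟩ := exists_orthogonal_notMem (Q := Q) e (Submodule.span K (Set.range e))
    (hlt (rank_span_range_le e) (by omega))
  have hperp {κ : Type} {x w : V} {e : κ → V} (hex : ∀ i, polar Q (e i) x = 0)
      (hw : w ∈ Submodule.span K (Set.range e)) : polar Q x w = 0 := by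
    induction hw using Submodule.span_induction with
    | mem w hw =>
      obtain ⟨i, rfl⟩ := hw
      rw [polar_comm, hex]
    | zero => exact polar_zero_right _ _
    | add w w' _ _ h h' => rw [polar_add_right, h, h', add_zero]
    | smul c w _ h => rw [polar_smul_right, h, smul_zero]
  let e₁ : Option κ → V := fun o => o.elim x e
  have he₁ : LinearIndependent K e₁ := linearIndependent_option.2 ⟨he, hx⟩
  obtain ⟨w₀, hw₀⟩ := exists_polar_eq hQ he₁ fun o => o.elim 1 b
  have hex₁ : ∀ o, polar Q (e₁ o) x = 0 := by
    rintro (_ | i)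
    · exact (polar_self Q x).trans (by rw [two_nsmul, CharTwo.add_self_eq_zero])
    · exact hex i
  have hxw₀ : polar Q x w₀ = 1 := hw₀ none
  let e₂ : Option (Option κ) → V := fun o => o.elim w₀ e₁
  have he₂ : LinearIndependent K e₂ := linearIndependent_option.2 ⟨he₁, fun hw =>
    one_ne_zero (hxw₀.symm.trans (hperp hex₁ hw))⟩
  -- The orthogonal complement of `e`, `x`, `w₀` contains a non-singular vector.
  obtain ⟨u, hu, hu0⟩ : ∃ u, (∀ o, polar Q (e₂ o) u = 0) ∧ Q u ≠ 0 := by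
    by_contra! hsing
    obtain ⟨y, hy, hey⟩ := exists_orthogonal_notMem (Q := Q) e₂ (Submodule.span K (Set.range e₂))
      (hlt (rank_span_range_le e₂) (by simp; omega))
    let e₃ : Option (Option (Option κ)) → V := fun o => o.elim y e₂
    have he₃ : LinearIndependent K e₃ := linearIndependent_option.2 ⟨he₂, hy⟩
    obtain ⟨z, hz⟩ := exists_polar_eq hQ he₃ fun o => o.elim 1 0
    have hyz : polar Q y z = 1 := hz none
    have hez : ∀ o, polar Q (e₂ o) z = 0 := fun o => hz (some o)
    rw [polar, hsing y hey, hsing z hez, hsing (y + z) fun o => by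
      rw [polar_add_right, hey, hez, add_zero] ] at hyz
    simp at hyz
  obtain ⟨c, hc⟩ := hsq ((s - Q w₀) / Q u)
  have hxu : polar Q x u = 0 := hu (some none)
  have hw₀u : polar Q w₀ u = 0 := hu none
  refine ⟨w₀ + c • u, fun hw => ?_, fun i => ?_, ?_⟩
  · have h := hperp hex hw
    rw [polar_add_right, polar_smul_right, hxw₀, hxu, smul_zero, add_zero] at h
    exact one_ne_zero h
  · have h1 : polar Q (e i) w₀ = b i := hw₀ (some i)
    have h2 : polar Q (e i) u = 0 := hu (some (some i))
    rw [polar_add_right, polar_smul_right, h1, h2, smul_zero, add_zero]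
  · rw [QuadraticMap.map_add Q, QuadraticMap.map_smul, polar_smul_right, hw₀u, hc, smul_zero,
      add_zero, smul_eq_mul, div_mul_cancel₀ _ hu0]
    ring

end Geometry

/-! ### Elimination of the vector sort in large dimension -/

section Large

/-- The quadratic function `∑ cᵢ pᵢⱼ cⱼ` on `K^ι` with coefficients `p`. -/
def coeffForm (ι : Type) [Fintype ι] (K : Type u) [Field K] (p : ι × ι → K) (c : ι → K) : K :=
  ∑ i, ∑ j, c i * p (i, j) * c j

theorem ufun_coeffForm (ι : Type) [Fintype ι] :
    UFun.{u} (α := ι × ι ⊕ ι) fun K _ _ v =>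
      coeffForm ι K (fun i => v (Sum.inl i)) (fun i => v (Sum.inr i)) :=
  UFun.sum fun _ => UFun.sum fun _ => ((UFun.var _).mul (UFun.var _)).mul (UFun.var _)

/-- Truth of `φ` in spaces of dimension at least `N` over perfect fields of characteristic two, at
vectors in the span of an independent family indexed by `ι`, is expressed by `P`, a predicate in the
field elements, the coordinates of the vectors, and coefficients of `q` on the family. -/
def ReducesTo {m n : ℕ} (φ : LFormula m n) (ι : Type) [Fintype ι] (N : ℕ)
    (P : ∀ (K : Type u) [Field K] [Ring.CompatibleRing K], (Ctx m n ι (ι × ι) → K) → Prop) : Prop :=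
  ∀ (K V : Type u) [Field K] [Ring.CompatibleRing K] [AddCommGroup V] [Module K V] [CharP K 2]
    (Q : QuadraticForm K V), (∀ c : K, ∃ y, y * y = c) → PolarNondegenerate Q →
    (N : Cardinal) ≤ Module.rank K V → ∀ e : ι → V, LinearIndependent K e →
    ∀ v : Ctx m n ι (ι × ι) → K,
    (∀ c : ι → K, Q (∑ i, c i • e i) = coeffForm ι K (fun p => v (Sum.inr p)) c) →
    (φ.Realize (orthStructure Q) (fun i => v (Sum.inl (Sum.inl i)))
      (fun j => ∑ i, v (Sum.inl (Sum.inr (j, i))) • e i) ↔ P K v)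

theorem ReducesTo.mono {m n : ℕ} {φ : LFormula m n} {ι : Type} [Fintype ι] {N N' : ℕ}
    {P : ∀ (K : Type u) [Field K] [Ring.CompatibleRing K], (Ctx m n ι (ι × ι) → K) → Prop}
    (h : ReducesTo φ ι N P) (hN : N ≤ N') : ReducesTo φ ι N' P :=
  fun K V _ _ _ _ _ Q hsq hQ hr => h K V Q hsq hQ ((Nat.cast_le.2 hN).trans hr)

/-- Formulas whose truth is reflected by injective isometries, such as atomic ones, can be evaluated
in the coordinate space `K^ι` with the form given by the coefficients. -/
theorem reducesTo_atomic {m n : ℕ} {φ : LFormula m n} {ι : Type} [Fintype ι]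
    (hdef : FormulaDef (ι := ι) (π := ι × ι) (fun K _ _ => coeffForm.{u} ι K) φ)
    (hmap : ∀ (K V W : Type u) [Field K] [Ring.CompatibleRing K] [AddCommGroup V] [Module K V]
      [AddCommGroup W] [Module K W] (q : V → K) (q' : W → K) (f : V →ₗ[K] W),
      Function.Injective f → (∀ x, q' (f x) = q x) → ∀ (a : Fin m → K) (v : Fin n → V),
      (φ.Realize (orthStructure q') a (fun i => f (v i)) ↔ φ.Realize (orthStructure q) a v)) :
    ∃ N P, UDef.{u} P ∧ ReducesTo φ ι N P := by
  refine ⟨0, _, hdef, fun K V _ _ _ _ _ Q _ _ _ e he v hv => ?_⟩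
  have := hmap K (ι → K) V (coeffForm ι K fun p => v (Sum.inr p)) Q (Fintype.linearCombination K e)
    (he.fintypeLinearCombination_injective)
    (fun c => by rw [Fintype.linearCombination_apply, hv])
    (fun i => v (Sum.inl (Sum.inl i))) (fun j i => v (Sum.inl (Sum.inr (j, i))))
  exact this

/-- The coefficients of `q` on a family extended by `w`. -/
theorem coeffForm_option {K V : Type u} [Field K] [AddCommGroup V] [Module K V]
    {Q : QuadraticForm K V} {ι : Type} [Fintype ι] {e : ι → V} {p : ι × ι → K}
    (hp : ∀ c : ι → K, Q (∑ i, c i • e i) = coeffForm ι K p c) (w : V)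
    (p' : Option ι × Option ι → K) (h1 : p' (none, none) = Q w)
    (h2 : ∀ i, p' (some i, none) = QuadraticMap.polar Q (e i) w) (h3 : ∀ i, p' (none, some i) = 0)
    (h4 : ∀ i j, p' (some i, some j) = p (i, j)) (c : Option ι → K) :
    Q (∑ o, c o • (o.elim w e : V)) = coeffForm (Option ι) K p' c := by
  have hpol : QuadraticMap.polar Q (∑ i, c (some i) • e i) w =
      ∑ i, c (some i) * QuadraticMap.polar Q (e i) w := by
    have h := LinearMap.congr_fun
      (map_sum Q.polarBilin (fun i => c (some i) • e i) Finset.univ) w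
    simpa only [LinearMap.sum_apply, map_smul, LinearMap.smul_apply,
      QuadraticMap.polarBilin_apply_apply, smul_eq_mul] using h
  rw [Fintype.sum_option, QuadraticMap.map_add Q]
  simp only [Option.elim_none, Option.elim_some]
  rw [QuadraticMap.map_smul, QuadraticMap.polar_smul_left, QuadraticMap.polar_comm, hpol, hp]
  simp only [coeffForm, Fintype.sum_option, h1, h2, h3, h4, Finset.sum_add_distrib]
  simp only [mul_zero, zero_mul, Finset.sum_const_zero, smul_eq_mul, Finset.mul_sum]
  rw [zero_add, add_right_comm]
  congr 2
  · ring
  · exact Finset.sum_congr rfl fun i _ => by ring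

/-- Induction on `φ`. The step for a quantifier over `V` uses the induction hypothesis for
the family, where the new vector is in the span, and for `Option ι`, where it extends the family. -/
theorem exists_reducesTo {m n : ℕ} (φ : LFormula m n) : ∀ (ι : Type) [Fintype ι],
    ∃ N P, UDef.{u} P ∧ ReducesTo φ ι N P := by
  induction φ with
  | falsum =>
    exact fun ι _ => ⟨0, _, UDef.const False, fun _ _ _ _ _ _ _ _ _ _ _ _ _ _ _ => Iff.rfl⟩
  | eqK t₁ t₂ =>
    intro ι _
    refine reducesTo_atomic (formulaDef_eqK (ufun_coeffForm ι) t₁ t₂) fun K V W _ _ _ _ _ _ q q' f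
      hf hq a v => ?_
    simp only [LFormula.realize_eqK, LTerm.realize_map f hf hq, sortMap]
  | eqV t₁ t₂ =>
    intro ι _
    refine reducesTo_atomic (formulaDef_eqV (ufun_coeffForm ι) t₁ t₂) fun K V W _ _ _ _ _ _ q q' f
      hf hq a v => ?_
    simp only [LFormula.realize_eqV, LTerm.realize_map f hf hq, sortMap, hf.eq_iff]
  | theta k ts =>
    intro ι _
    refine reducesTo_atomic (formulaDef_theta (ufun_coeffForm ι) k ts) fun K V W _ _ _ _ _ _ q q' f
      hf hq a v => ?_
    simp only [LFormula.realize_theta, LTerm.realize_map f hf hq, sortMap]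
    exact f.linearIndependent_iff (LinearMap.ker_eq_bot.2 hf)
  | imp φ ψ ih₁ ih₂ =>
    intro ι _
    obtain ⟨N₁, P₁, hP₁, h₁⟩ := ih₁ ι
    obtain ⟨N₂, P₂, hP₂, h₂⟩ := ih₂ ι
    exact ⟨max N₁ N₂, _, hP₁.imp hP₂, fun K V _ _ _ _ _ Q hsq hQ hr e he v hv =>
      imp_congr (h₁.mono (le_max_left _ _) K V Q hsq hQ hr e he v hv)
        (h₂.mono (le_max_right _ _) K V Q hsq hQ hr e he v hv)⟩
  | @allK m n φ ih =>
    intro ι _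
    obtain ⟨N, P, hP, h⟩ := ih ι
    let r : Ctx (m + 1) n ι (ι × ι) → Ctx m n ι (ι × ι) ⊕ Unit :=
      Sum.elim (Sum.elim (Fin.lastCases (Sum.inr ()) fun i => Sum.inl (Sum.inl (Sum.inl i)))
        fun p => Sum.inl (Sum.inl (Sum.inr p))) fun i => Sum.inl (Sum.inr i)
    refine ⟨N, _, (hP.reindex r).all_sum, fun K V _ _ _ _ _ Q hsq hQ hr e he v hv => ?_⟩
    have key (c : Unit → K) := h K V Q hsq hQ hr e he (fun i => Sum.elim v c (r i)) hv
    rw [LFormula.realize_allK, (Equiv.funUnique Unit K).symm.surjective.forall]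
    refine forall_congr' fun c => ((iff_of_eq ?_).trans (key _))
    refine congrArg₂ _ (funext fun i => ?_) rfl
    refine Fin.lastCases ?_ (fun i => ?_) i <;> simp [r]
  | @allV m n φ ih =>
    intro ι _
    obtain ⟨N₁, P₁, hP₁, h₁⟩ := ih ι
    obtain ⟨N₂, P₂, hP₂, h₂⟩ := ih (Option ι)
    -- Either the new vector is in the span of the family, with coordinates `c` …
    let r : Ctx m (n + 1) ι (ι × ι) → Ctx m n ι (ι × ι) ⊕ ι :=
      Sum.elim (Sum.elim (fun i => Sum.inl (Sum.inl (Sum.inl i)))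
        fun p => Fin.lastCases (Sum.inr p.2) (fun j => Sum.inl (Sum.inl (Sum.inr (j, p.2)))) p.1)
        fun i => Sum.inl (Sum.inr i)
    -- … or it extends the family, and `g` lists its values of `q` and `β`.
    let val : Ctx m (n + 1) (Option ι) (Option ι × Option ι) →
        ∀ (K : Type u) [Field K] [Ring.CompatibleRing K], (Ctx m n ι (ι × ι) ⊕ Option ι → K) → K :=
      fun x K _ _ v => match x with
      | Sum.inl (Sum.inl i) => v (Sum.inl (Sum.inl (Sum.inl i)))
      | Sum.inl (Sum.inr (j, none)) => Fin.lastCases 1 (fun _ => 0) j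
      | Sum.inl (Sum.inr (j, some i)) =>
        Fin.lastCases 0 (fun j => v (Sum.inl (Sum.inl (Sum.inr (j, i))))) j
      | Sum.inr (o, none) => v (Sum.inr o)
      | Sum.inr (none, some _) => 0
      | Sum.inr (some i, some j) => v (Sum.inl (Sum.inr (i, j)))
    have hval : ∀ x, UFun (val x) := by
      rintro ((i | ⟨j, _ | i⟩) | ⟨_ | i, _ | j⟩)
      · exact UFun.var _
      · refine Fin.lastCases ?_ (fun j => ?_) j
        · exact UFun.one.congr fun K _ _ v => by simp [val]
        · exact UFun.zero.congr fun K _ _ v => by simp [val]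
      · refine Fin.lastCases ?_ (fun j => ?_) j
        · exact UFun.zero.congr fun K _ _ v => by simp [val]
        · exact (UFun.var _).congr fun K _ _ v => by simp [val]; rfl
      · exact UFun.var _
      · exact UFun.zero
      · exact UFun.var _
      · exact UFun.var _
    refine ⟨max (max N₁ N₂) (2 * Fintype.card ι + 5), _,
      (hP₁.reindex r).all_sum.and (hP₂.comp hval).all_sum, ?_⟩
    · intro K V _ _ _ _ _ Q hsq hQ hr e he v hv
      replace h₁ := h₁.mono ((le_max_left _ _).trans (le_max_left _ _)) K V Q hsq hQ hr
      replace h₂ := h₂.mono ((le_max_right _ _).trans (le_max_left _ _)) K V Q hsq hQ hr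
      have hr' := (Nat.cast_le.2 (le_max_right _ _)).trans hr
      have key₁ (c : ι → K) : φ.Realize (orthStructure Q) (fun i => v (Sum.inl (Sum.inl i)))
          (Fin.snoc (α := fun _ => V) (fun j => ∑ i, v (Sum.inl (Sum.inr (j, i))) • e i)
            (∑ i, c i • e i)) ↔ P₁ K fun i => Sum.elim v c (r i) := by
        rw [← h₁ e he (fun i => Sum.elim v c (r i)) hv]
        refine iff_of_eq (congrArg _ (funext fun j => ?_))
        refine Fin.lastCases ?_ (fun j => ?_) j <;> simp [r]
      have key₂ (w : V) (hw : w ∉ Submodule.span K (Set.range e)) (g : Option ι → K)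
          (hgw : g none = Q w) (hg : ∀ i, g (some i) = QuadraticMap.polar Q (e i) w) :
          φ.Realize (orthStructure Q) (fun i => v (Sum.inl (Sum.inl i)))
          (Fin.snoc (α := fun _ => V) (fun j => ∑ i, v (Sum.inl (Sum.inr (j, i))) • e i) w) ↔
          P₂ K fun i => val i K (Sum.elim v g) := by
        rw [← h₂ (fun o => o.elim w e) (linearIndependent_option.2 ⟨he, hw⟩)
          (fun i => val i K (Sum.elim v g))
          (coeffForm_option hv w _ hgw hg (fun _ => rfl) fun _ _ => rfl)]
        refine iff_of_eq (congrArg _ (funext fun j => ?_))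
        refine Fin.lastCases ?_ (fun j => ?_) j <;> simp [val, Fintype.sum_option]
      refine ⟨fun h => ⟨fun c => (key₁ c).1 (h _), fun g => ?_⟩, fun h w => ?_⟩
      · obtain ⟨w, hw, hb, hs⟩ := exists_extension hsq hQ he hr' (fun i => g (some i)) (g none)
        exact (key₂ w hw g hs.symm fun i => (hb i).symm).1 (h w)
      · by_cases hw : w ∈ Submodule.span K (Set.range e)
        · obtain ⟨c, rfl⟩ := (Submodule.mem_span_range_iff_exists_fun K).1 hw
          exact (key₁ c).2 (h.1 c)
        · exact (key₂ w hw (fun o => o.elim (Q w) fun i => QuadraticMap.polar Q (e i) w) rfl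
            fun i => rfl).2 (h.2 _)

/-- In large dimension over perfect fields of characteristic two, the truth of a sentence depends
only on the truth of a sentence in the field. -/
theorem exists_sentence_of_large_rank (φ : LSentence) : ∃ (N : ℕ) (ψ : Language.ring.Sentence),
    ∀ (K V : Type u) [Field K] [Ring.CompatibleRing K] [AddCommGroup V] [Module K V] [CharP K 2]
    (Q : QuadraticForm K V), (∀ c : K, ∃ y, y * y = c) → PolarNondegenerate Q →
    (N : Cardinal) ≤ Module.rank K V → ((orthStructure Q).Satisfies φ ↔ K ⊨ ψ) := by
  obtain ⟨N, P, hP, h⟩ := exists_reducesTo.{u} φ Empty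
  have hempty : IsEmpty (Ctx 0 0 Empty (Empty × Empty)) := inferInstance
  obtain ⟨ψ, hψ⟩ := UDef.exists_sentence
    ((hP.reindex fun x => hempty.elim x).congr
      (Q := fun K _ _ _ => P K fun x => hempty.elim x) fun K _ _ v =>
        iff_of_eq (congrArg _ (Subsingleton.elim _ _)))
  refine ⟨N, ψ, fun K V _ _ _ _ _ Q hsq hQ hr => ?_⟩
  rw [hψ, ← h K V Q hsq hQ hr Empty.elim linearIndependent_empty_type _
    fun c => by simp [coeffForm] ]
  exact iff_of_eq (congrArg₂ (φ.Realize (orthStructure Q))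
    (Subsingleton.elim (α := Fin 0 → K) _ _) (Subsingleton.elim (α := Fin 0 → V) _ _))

end Large

/-! ### Symplectic families -/

/-- The family `e` with the pair `x, y` added. -/
def snocPair {X : Type*} {k : ℕ} (e : Fin k × Bool → X) (x y : X) (z : Fin (k + 1) × Bool) : X :=
  Fin.lastCases (motive := fun _ => X) (bif z.2 then y else x) (fun i => e (i, z.2)) z.1

@[simp] theorem snocPair_castSucc {X : Type*} {k : ℕ} (e : Fin k × Bool → X) (x y : X)
    (i : Fin k) (a : Bool) :
    snocPair e x y (i.castSucc, a) = e (i, a) := by simp [snocPair]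

@[simp] theorem snocPair_last_false {X : Type*} {k : ℕ} (e : Fin k × Bool → X)
    (x y : X) :
    snocPair e x y (Fin.last k, false) = x := by simp [snocPair]

@[simp] theorem snocPair_last_true {X : Type*} {k : ℕ} (e : Fin k × Bool → X)
    (x y : X) :
    snocPair e x y (Fin.last k, true) = y := by simp [snocPair]

section Symplectic

open QuadraticMap

variable {K V : Type u} [Field K] [AddCommGroup V] [Module K V] {Q : QuadraticForm K V}
  {κ : Type} [DecidableEq κ]

/-- A family of pairs of vectors that is a symplectic basis of its span, for the polar form. -/
def IsSymplectic (Q : QuadraticForm K V) (e : κ × Bool → V) : Prop :=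
  ∀ x y, polar Q (e x) (e y) = if x.1 = y.1 ∧ x.2 ≠ y.2 then 1 else 0

theorem polar_sum_left {ι : Type*} (s : Finset ι) (f : ι → V) (w : V) :
    polar Q (∑ i ∈ s, f i) w = ∑ i ∈ s, polar Q (f i) w := by
  have h := LinearMap.congr_fun (map_sum Q.polarBilin f s) w
  simpa only [LinearMap.sum_apply, polarBilin_apply_apply] using h

/-- `Q` is additive on sums of pairwise orthogonal vectors. -/
theorem map_sum_of_orthogonal {ι : Type*} (s : Finset ι) (f : ι → V)
    (h : ∀ i j, i ≠ j → polar Q (f i) (f j) = 0) : Q (∑ i ∈ s, f i) = ∑ i ∈ s, Q (f i) := by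
  classical
  induction s using Finset.induction_on with
  | empty => simp
  | insert i s hi ih =>
    have h0 : polar Q (∑ j ∈ s, f j) (f i) = 0 := by
      rw [polar_sum_left]
      exact Finset.sum_eq_zero fun j hj => h j i fun hji => hi (hji ▸ hj)
    rw [Finset.sum_insert hi, Finset.sum_insert hi, QuadraticMap.map_add Q, ih, polar_comm, h0,
      add_zero]

variable [Fintype κ]

theorem IsSymplectic.polar_sum {e : κ × Bool → V} (he : IsSymplectic Q e) (c : κ × Bool → K)
    (i : κ) (a : Bool) : polar Q (∑ x, c x • e x) (e (i, a)) = c (i, !a) := by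
  rw [polar_sum_left, Finset.sum_eq_single (i, !a)]
  · rw [polar_smul_left, he]
    simp
  · rintro ⟨j, b⟩ - h
    rw [polar_smul_left, he, if_neg, smul_zero]
    rintro ⟨h1, h2⟩
    refine h (Prod.ext h1 ?_)
    simpa using Bool.eq_not_of_ne h2
  · simp

theorem IsSymplectic.linearIndependent {e : κ × Bool → V} (he : IsSymplectic Q e) :
    LinearIndependent K e := by
  rw [Fintype.linearIndependent_iff]
  rintro c hc ⟨i, a⟩
  have := he.polar_sum c i (!a)
  rw [hc, polar_zero_left, Bool.not_not] at this
  exact this.symm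

theorem IsSymplectic.map_sum {e : κ × Bool → V} (he : IsSymplectic Q e) (c : κ × Bool → K) :
    Q (∑ x, c x • e x) = ∑ i, (c (i, false) * c (i, false) * Q (e (i, false)) +
      c (i, true) * c (i, true) * Q (e (i, true)) + c (i, false) * c (i, true)) := by
  rw [Fintype.sum_prod_type, map_sum_of_orthogonal]
  · refine Finset.sum_congr rfl fun i _ => ?_
    rw [Fintype.sum_bool, QuadraticMap.map_add Q, QuadraticMap.map_smul, QuadraticMap.map_smul,
      polar_smul_left, polar_smul_right, he]
    simp
    ring
  · intro i j hij
    simp [polar_add_left, polar_add_right, polar_smul_left, polar_smul_right, he (i, _) (j, _), hij]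

theorem IsSymplectic.notMem_span {e : κ × Bool → V} (he : IsSymplectic Q e) {x : V} (hx : x ≠ 0)
    (hxe : ∀ z, polar Q (e z) x = 0) : x ∉ Submodule.span K (Set.range e) := by
  intro h
  obtain ⟨c, rfl⟩ := (Submodule.mem_span_range_iff_exists_fun K).1 h
  refine hx (Finset.sum_eq_zero fun z _ => ?_)
  have h1 := he.polar_sum c z.1 (!z.2)
  rw [polar_comm, hxe, Bool.not_not] at h1
  rw [← h1, zero_smul]

/-- A non-zero vector orthogonal to a symplectic family has a partner orthogonal to the family. -/
theorem IsSymplectic.exists_partner (hQ : PolarNondegenerate Q) {e : κ × Bool → V}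
    (he : IsSymplectic Q e) {x : V} (hx : x ≠ 0) (hxe : ∀ z, polar Q (e z) x = 0) :
    ∃ y, (∀ z, polar Q (e z) y = 0) ∧ polar Q x y = 1 := by
  obtain ⟨y, hy⟩ := exists_polar_eq (e := fun o : Option (κ × Bool) => o.elim x e) hQ
    (linearIndependent_option.2 ⟨he.linearIndependent, he.notMem_span hx hxe⟩)
    fun o => o.elim 1 0
  exact ⟨y, fun z => hy (some z), hy none⟩

variable [CharP K 2]

theorem polar_self_eq_zero (x : V) : polar Q x x = 0 := by
  rw [polar_self, two_nsmul, CharTwo.add_self_eq_zero]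

theorem IsSymplectic.snocPair {k : ℕ} {e : Fin k × Bool → V} (he : IsSymplectic Q e) {x y : V}
    (hx : ∀ z, polar Q (e z) x = 0) (hy : ∀ z, polar Q (e z) y = 0) (hxy : polar Q x y = 1) :
    IsSymplectic Q (snocPair e x y) := by
  have hyx : polar Q y x = 1 := by rw [polar_comm, hxy]
  have hx' (z) : polar Q x (e z) = 0 := by rw [polar_comm, hx]
  have hy' (z) : polar Q y (e z) = 0 := by rw [polar_comm, hy]
  rintro ⟨i, a⟩ ⟨j, b⟩
  refine Fin.lastCases ?_ (fun i => ?_) i <;> refine Fin.lastCases ?_ (fun j => ?_) j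
  · rcases a with _ | _ <;> rcases b with _ | _ <;> simp [hxy, hyx, CharTwo.two_eq_zero]
  · rcases a with _ | _ <;> simp [hx', hy', (Fin.castSucc_lt_last j).ne']
  · rcases b with _ | _ <;> simp [hx, hy, (Fin.castSucc_lt_last i).ne]
  · rw [snocPair_castSucc, snocPair_castSucc, he]
    simp

/-- The orthogonal complement of `2k` vectors contains a non-zero singular vector if it has
dimension at least three: `q` is semilinear on any plane on which the polar form vanishes. -/
theorem exists_singular (hsq : ∀ c : K, ∃ y, y * y = c) {k : ℕ} (e : Fin k × Bool → V)
    (hr : ((2 * k + 3 : ℕ) : Cardinal) ≤ Module.rank K V) :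
    ∃ x, x ≠ 0 ∧ (∀ z, polar Q (e z) x = 0) ∧ Q x = 0 := by
  obtain ⟨x, hx, hex⟩ := exists_orthogonal_notMem (Q := Q) e ⊥ (by
    rw [rank_bot, add_zero]
    refine lt_of_lt_of_le ?_ hr
    simp only [Fintype.card_prod, Fintype.card_fin, Fintype.card_bool]
    exact_mod_cast (by omega))
  obtain ⟨y, hy, hey⟩ := exists_orthogonal_notMem (Q := Q)
    (fun o : Option (Fin k × Bool) => o.elim x e) (Submodule.span K (Set.range fun _ : Unit => x))
    ((add_le_add le_rfl (rank_span_range_le _)).trans_lt (by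
      refine lt_of_lt_of_le ?_ hr
      simp only [Fintype.card_option, Fintype.card_prod, Fintype.card_fin, Fintype.card_bool,
        Fintype.card_unit]
      exact_mod_cast (by omega)))
  have hxy : polar Q x y = 0 := hey none
  by_cases hQx : Q x = 0
  · exact ⟨x, fun h => hx (h ▸ zero_mem _), hex, hQx⟩
  · obtain ⟨c, hc⟩ := hsq (Q y / Q x)
    refine ⟨c • x + y, fun h => hy ?_, fun z => ?_, ?_⟩
    · rw [eq_neg_of_add_eq_zero_right h]
      exact neg_mem (Submodule.smul_mem _ _ (Submodule.subset_span ⟨(), rfl⟩))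
    · rw [polar_add_right, polar_smul_right, hex, smul_zero, zero_add]
      exact hey (some z)
    · rw [QuadraticMap.map_add Q, QuadraticMap.map_smul, polar_smul_left, hxy, hc, smul_zero,
        add_zero, smul_eq_mul, div_mul_cancel₀ _ hQx, CharTwo.add_self_eq_zero]

/-- Hyperbolic planes can be split off as long as the dimension of the complement is at least
three. -/
theorem exists_hyperbolic (hsq : ∀ c : K, ∃ y, y * y = c) (hQ : PolarNondegenerate Q) (k : ℕ)
    (hr : ((2 * k + 1 : ℕ) : Cardinal) ≤ Module.rank K V) :
    ∃ e : Fin k × Bool → V, IsSymplectic Q e ∧ ∀ z, Q (e z) = 0 := by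
  induction k with
  | zero => exact ⟨fun z => z.1.elim0, fun z => z.1.elim0, fun z => z.1.elim0⟩
  | succ k ih =>
    obtain ⟨e, he, he0⟩ := ih (le_trans (by exact_mod_cast (by omega)) hr)
    obtain ⟨x, hx, hex, hQx⟩ := exists_singular (Q := Q) hsq e hr
    obtain ⟨y, hey, hxy⟩ := he.exists_partner hQ hx hex
    refine ⟨snocPair e x (y + Q y • x), he.snocPair hex (fun z => ?_) ?_, ?_⟩
    · rw [polar_add_right, polar_smul_right, hex, hey, smul_zero, add_zero]
    · rw [polar_add_right, polar_smul_right, polar_self_eq_zero, hxy, smul_zero, add_zero]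
    · rintro ⟨i, a⟩
      refine Fin.lastCases ?_ (fun i => ?_) i
      · rcases a with _ | _
        · simp [hQx]
        · rw [snocPair_last_true, QuadraticMap.map_add Q, QuadraticMap.map_smul, polar_smul_right,
            polar_comm, hxy, hQx]
          simp [CharTwo.add_self_eq_zero]
      · simp [he0]

end Symplectic

/-! ### Standard bases -/

section Standard

open QuadraticMap

variable {K V : Type u} [Field K] [AddCommGroup V] [Module K V] {Q : QuadraticForm K V} {k : ℕ}

/-- A family of `2(k + 1)` vectors consisting of `k` hyperbolic pairs and one pair on which `q` is
`x² + xy + dy²`. -/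
structure IsStandard (Q : QuadraticForm K V) (e : Fin (k + 1) × Bool → V) (d : K) : Prop where
  symplectic : IsSymplectic Q e
  castSucc : ∀ i a, Q (e (Fin.castSucc i, a)) = 0
  last_false : Q (e (Fin.last k, false)) = 1
  last_true : Q (e (Fin.last k, true)) = d

/-- The quadratic form `∑ xᵢyᵢ + x_k² + dy_k²` on `K^{2(k+1)}`. -/
def stdForm (k : ℕ) (K : Type u) [Field K] (d : K) (c : Fin (k + 1) × Bool → K) : K :=
  c (Fin.last k, false) * c (Fin.last k, false) +
    d * (c (Fin.last k, true) * c (Fin.last k, true)) + ∑ i, c (i, false) * c (i, true)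

theorem IsStandard.map_sum {e : Fin (k + 1) × Bool → V} {d : K} (he : IsStandard Q e d)
    (c : Fin (k + 1) × Bool → K) : Q (∑ x, c x • e x) = stdForm k K d c := by
  rw [he.symplectic.map_sum, Finset.sum_add_distrib, stdForm, Fin.sum_univ_castSucc]
  simp only [he.castSucc, he.last_false, he.last_true, mul_zero, add_zero, mul_one,
    Finset.sum_const_zero, zero_add]
  ring

theorem IsStandard.exists_equiv {e : Fin (k + 1) × Bool → V} {d : K} (he : IsStandard Q e d)
    (hV : Module.finrank K V = 2 * (k + 1)) :
    ∃ f : (Fin (k + 1) × Bool → K) ≃ₗ[K] V, (∀ c, f c = ∑ x, c x • e x) ∧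
      ∀ c, Q (f c) = stdForm k K d c := by
  have hf (c) : (basisOfLinearIndependentOfCardEqFinrank he.symplectic.linearIndependent
      (by simp [hV, mul_comm])).equivFun.symm c = ∑ x, c x • e x := by
    rw [Module.Basis.equivFun_symm_apply]
    simp
  exact ⟨_, hf, fun c => by rw [hf, he.map_sum]⟩

variable [CharP K 2]

/-- The parameter of a standard basis can be changed by elements of the form `t² + t`. -/
theorem IsStandard.change {e : Fin (k + 1) × Bool → V} {d d' t : K} (he : IsStandard Q e d)
    (ht : d + d' = t * t + t) : ∃ e' : Fin (k + 1) × Bool → V, IsStandard Q e' d' := by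
  have hs := he.symplectic
  have he' : snocPair (fun z => e (z.1.castSucc, z.2)) (e (Fin.last k, false))
      (e (Fin.last k, true)) = e := by
    funext ⟨i, a⟩
    refine Fin.lastCases ?_ (fun i => ?_) i
    · rcases a with _ | _ <;> simp
    · simp
  have hne (i : Fin k) : Fin.castSucc i ≠ Fin.last k := (Fin.castSucc_lt_last i).ne
  refine ⟨snocPair (fun z => e (z.1.castSucc, z.2)) (e (Fin.last k, false))
      (e (Fin.last k, true) + t • e (Fin.last k, false)), IsSymplectic.snocPair ?_ ?_ ?_ ?_, ?_,
      ?_, ?_⟩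
  · intro x y
    rw [hs]
    simp
  · intro z
    rw [hs]
    simp [hne]
  · intro z
    rw [polar_add_right, polar_smul_right, hs, hs]
    simp [hne]
  · rw [polar_add_right, polar_smul_right, hs, hs]
    simp
  · simp [he.castSucc]
  · simp [he.last_false]
  · rw [snocPair_last_true, QuadraticMap.map_add Q, QuadraticMap.map_smul, polar_smul_right, hs,
      he.last_true, he.last_false]
    simp only [ne_eq, Bool.true_eq_false, not_false_eq_true, and_self, if_true, smul_eq_mul,
      mul_one]
    rw [add_assoc, ← ht, ← add_assoc, CharTwo.add_self_eq_zero, zero_add]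

/-- Over a perfect field of characteristic two, a non-degenerate space of positive finite dimension
has a standard basis. -/
theorem exists_isStandard (hsq : ∀ c : K, ∃ y, y * y = c) (hQ : PolarNondegenerate Q)
    [Module.Finite K V] (hV : 0 < Module.finrank K V) :
    ∃ k d, Module.finrank K V = 2 * (k + 1) ∧
      ∃ e : Fin (k + 1) × Bool → V, IsStandard Q e d := by
  obtain ⟨k, hk1, hk2⟩ : ∃ k, 2 * k + 1 ≤ Module.finrank K V ∧ Module.finrank K V ≤ 2 * k + 2 :=
    ⟨(Module.finrank K V - 1) / 2, by omega, by omega⟩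
  obtain ⟨e, he, he0⟩ := exists_hyperbolic hsq hQ k (by
    rw [← Module.finrank_eq_rank]; exact_mod_cast hk1)
  obtain ⟨x, hx, hex⟩ := exists_orthogonal_notMem (Q := Q) e ⊥ (by
    rw [rank_bot, add_zero, ← Module.finrank_eq_rank]
    simp only [Fintype.card_prod, Fintype.card_fin, Fintype.card_bool]
    exact_mod_cast (by omega))
  obtain ⟨y, hey, hxy⟩ := he.exists_partner hQ hx hex
  have hcard := (he.snocPair hex hey hxy).linearIndependent.fintype_card_le_finrank
  simp only [Fintype.card_prod, Fintype.card_fin, Fintype.card_bool] at hcard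
  obtain ⟨z, hez, hz⟩ : ∃ z, (∀ i, polar Q (e i) z = 0) ∧ Q z ≠ 0 := by
    by_contra! h
    rw [polar, h x hex, h y hey, h (x + y) fun i => by
      rw [polar_add_right, hex, hey, add_zero] ] at hxy
    simp at hxy
  obtain ⟨c, hc⟩ := hsq (Q z)⁻¹
  have hez' : ∀ i, polar Q (e i) (c • z) = 0 := fun i => by
    rw [polar_smul_right, hez, smul_zero]
  have hQz : Q (c • z) = 1 := by rw [QuadraticMap.map_smul, hc, smul_eq_mul, inv_mul_cancel₀ hz]
  obtain ⟨w, hew, hzw⟩ := he.exists_partner hQ (x := c • z)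
    (fun h => by rw [h, QuadraticMap.map_zero] at hQz; exact zero_ne_one hQz) hez'
  exact ⟨k, Q w, by omega, snocPair e (c • z) w, he.snocPair hez' hew hzw, by simp [he0],
    by simpa using hQz, by simp⟩

end Standard

/-! ### The Witt index -/

section Witt

open QuadraticMap

variable {K V : Type u} [Field K] [AddCommGroup V] [Module K V] {Q : QuadraticForm K V} {k : ℕ}

/-- There is a totally singular subspace of dimension `r`. -/
def WittIndexGE (Q : V → K) (r : ℕ) : Prop :=
  ∃ u : Fin r → V, LinearIndependent K u ∧ (∀ i, Q (u i) = 0) ∧ ∀ i j, polar Q (u i) (u j) = 0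

theorem eq_zero_of_mem_span {ι : Type*} [Fintype ι] {u : ι → V} (h1 : ∀ i, Q (u i) = 0)
    (h2 : ∀ i j, polar Q (u i) (u j) = 0) {v : V} (hv : v ∈ Submodule.span K (Set.range u)) :
    Q v = 0 := by
  obtain ⟨c, rfl⟩ := (Submodule.mem_span_range_iff_exists_fun K).1 hv
  rw [map_sum_of_orthogonal]
  · exact Finset.sum_eq_zero fun i _ => by rw [QuadraticMap.map_smul, h1, smul_zero]
  · intro i j _
    rw [polar_smul_left, polar_smul_right, h2, smul_zero, smul_zero]

/-- A totally singular subspace is contained in its own orthogonal complement. -/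
theorem WittIndexGE.two_mul_le [Module.Finite K V] (hQ : PolarNondegenerate Q) {r : ℕ}
    (h : WittIndexGE Q r) : 2 * r ≤ Module.finrank K V := by
  obtain ⟨u, hu, -, h2⟩ := h
  let T : V →ₗ[K] (Fin r → K) := LinearMap.pi fun i => Q.polarBilin (u i)
  have hT : LinearMap.range T = ⊤ := by
    refine LinearMap.range_eq_top.2 fun b => ?_
    obtain ⟨w, hw⟩ := exists_polar_eq hQ hu b
    exact ⟨w, funext hw⟩
  have hle : Submodule.span K (Set.range u) ≤ LinearMap.ker T := by
    rw [Submodule.span_le]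
    rintro _ ⟨j, rfl⟩
    exact funext fun i => h2 i j
  have h1 := LinearMap.finrank_range_add_finrank_ker T
  have h3 := Submodule.finrank_mono hle
  rw [hT, finrank_top, Module.finrank_fin_fun] at h1
  rw [finrank_span_eq_card hu, Fintype.card_fin] at h3
  omega

/-- If all singular vectors orthogonal to the totally singular subspace `X` are in `X`, then no
totally singular subspace has larger dimension: for a complement `Y` of `U ∩ X` in `X`, the polar
form embeds `U / (U ∩ X)` into the dual of `Y`. -/
theorem finrank_le_of_totally_singular [Module.Finite K V] {X U : Submodule K V}
    (hX : ∀ v, Q v = 0 → (∀ x ∈ X, polar Q x v = 0) → v ∈ X)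
    (hU : ∀ u ∈ U, Q u = 0) : Module.finrank K U ≤ Module.finrank K X := by
  have hpol {u v : V} (hu : u ∈ U) (hv : v ∈ U) : polar Q u v = 0 := by
    rw [polar, hU u hu, hU v hv, hU _ (add_mem hu hv), sub_zero, sub_zero]
  obtain ⟨Y, hY⟩ := Submodule.exists_isCompl (U.comap X.subtype)
  let T : U →ₗ[K] Module.Dual K Y :=
    LinearMap.mk₂ K (fun (u : U) (y : Y) => polar Q (u : V) ((y : X) : V))
      (fun u u' y => polar_add_left Q _ _ _) (fun c u y => polar_smul_left Q _ _ _)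
      (fun u y y' => polar_add_right Q _ _ _) fun c u y => polar_smul_right Q _ _ _
  have hker (u : U) (hu : u ∈ LinearMap.ker T) : (u : V) ∈ X := by
    refine hX u (hU u u.2) fun x hx => ?_
    obtain ⟨a, ha, b, hb, hab⟩ := Submodule.mem_sup.1
      (hY.sup_eq_top ▸ Submodule.mem_top : (⟨x, hx⟩ : X) ∈ U.comap X.subtype ⊔ Y)
    have hx' : x = (a : V) + b := (congrArg Subtype.val hab).symm
    rw [hx', polar_add_left, hpol (u := (a : V)) ha u.2, zero_add, polar_comm]
    exact LinearMap.congr_fun (LinearMap.mem_ker.1 hu) (⟨b, hb⟩ : Y)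
  let f : LinearMap.ker T →ₗ[K] U.comap X.subtype :=
    { toFun := fun u => ⟨⟨u, hker u u.2⟩, (u : U).2⟩
      map_add' := fun _ _ => rfl
      map_smul' := fun _ _ => rfl }
  have hf : Function.Injective f := fun u v huv =>
    Subtype.ext (Subtype.ext (congrArg (fun z : U.comap X.subtype => ((z : X) : V)) huv))
  have h1 := LinearMap.finrank_range_add_finrank_ker T
  have h2 := (LinearMap.range T).finrank_le
  have h3 := LinearMap.finrank_le_finrank_of_injective hf
  have h4 := Submodule.finrank_add_eq_of_isCompl hY
  rw [Subspace.dual_finrank_eq] at h2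
  omega

variable {e : Fin (k + 1) × Bool → V} {d : K}

theorem IsStandard.wittIndexGE (he : IsStandard Q e d) : WittIndexGE Q k :=
  ⟨fun i => e (i.castSucc, true), he.symplectic.linearIndependent.comp _ fun i j h => by
    simpa using h, fun i => he.castSucc i true, fun i j => by rw [he.symplectic]; simp⟩

theorem IsStandard.wittIndexGE_succ [CharP K 2] (he : IsStandard Q e d)
    (hd : ∃ t, d = t * t + t) : WittIndexGE Q (k + 1) := by
  obtain ⟨t, ht⟩ := hd
  obtain ⟨e', he'⟩ := he.change (d' := 0) (t := t) (by rw [add_zero, ht])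
  refine ⟨fun i => e' (i, true), he'.symplectic.linearIndependent.comp _ fun i j h => by
    simpa using h, fun i => ?_, fun i j => by rw [he'.symplectic]; simp⟩
  exact Fin.lastCases he'.last_true (fun i => he'.castSucc i true) i

/-- If `d` is not of the form `t² + t`, the last pair spans an anisotropic plane, and the span of
the first vectors of the hyperbolic pairs is a maximal totally singular
subspace, so `finrank_le_of_totally_singular` bounds the dimension of the others. -/
theorem IsStandard.not_wittIndexGE_succ [CharP K 2] (he : IsStandard Q e d)
    (hV : Module.finrank K V = 2 * (k + 1)) (hd : ¬ ∃ t, d = t * t + t) :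
    ¬ WittIndexGE Q (k + 1) := by
  rintro ⟨u, hu, hu1, hu2⟩
  have hfin : Module.Finite K V := Module.finite_of_finrank_pos (by omega)
  let x : Fin k → V := fun i => e (i.castSucc, false)
  obtain ⟨f, hf, hQf⟩ := he.exists_equiv hV
  have h := finrank_le_of_totally_singular (Q := Q) (X := Submodule.span K (Set.range x))
    (U := Submodule.span K (Set.range u)) ?_ fun v hv => eq_zero_of_mem_span hu1 hu2 hv
  · have h1 : Module.finrank K (Submodule.span K (Set.range x)) ≤ Fintype.card (Fin k) :=
      finrank_range_le_card x
    rw [finrank_span_eq_card hu] at h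
    simp at h h1
    omega
  · intro v hv hxv
    obtain ⟨c, rfl⟩ := f.surjective v
    have hc (i : Fin k) : c (i.castSucc, true) = 0 := by
      have := hxv _ (Submodule.subset_span ⟨i, rfl⟩)
      rw [hf, polar_comm, he.symplectic.polar_sum] at this
      exact this
    rw [hQf, stdForm, Fin.sum_univ_castSucc] at hv
    simp only [hc, mul_zero, Finset.sum_const_zero, zero_add] at hv
    -- `x² + xy + dy²` is anisotropic as `d` is not of the form `t² + t`.
    have h1 : c (Fin.last k, true) = 0 := by
      by_contra h1
      refine hd ⟨c (Fin.last k, false) / c (Fin.last k, true), ?_⟩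
      have h2 : d * (c (Fin.last k, true) * c (Fin.last k, true)) =
          c (Fin.last k, false) * c (Fin.last k, false) +
          c (Fin.last k, false) * c (Fin.last k, true) := by
        rw [← CharTwo.add_eq_zero, ← hv]
        ring
      field_simp
      linear_combination h2
    have h0 : c (Fin.last k, false) = 0 := by
      rw [h1] at hv
      simpa using hv
    rw [hf, Fintype.sum_prod_type, Fin.sum_univ_castSucc]
    refine add_mem (sum_mem fun i _ => ?_) ?_
    · rw [Fintype.sum_bool, hc, zero_smul, zero_add]
      exact Submodule.smul_mem _ _ (Submodule.subset_span ⟨i, rfl⟩)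
    · rw [Fintype.sum_bool, h1, h0, zero_smul, zero_smul, add_zero]
      exact zero_mem _

end Witt

/-! ### Finite and pseudo-finite fields of characteristic two -/

section Fields

/-- The first-order properties of finite fields of characteristic two that determine their
quadratic forms: they are perfect, and the image of `t ↦ t² + t` has index two. -/
structure IsGoodField (K : Type u) [Field K] : Prop where
  sq : ∀ c : K, ∃ y, y * y = c
  exists_ne : ∃ d : K, ∀ t, d ≠ t * t + t
  exists_add : ∀ a b : K, (∀ t, a ≠ t * t + t) → (∀ t, b ≠ t * t + t) → ∃ t, a + b = t * t + t

theorem udef_isGoodField : UDef.{u} (α := Empty) fun K _ _ _ => IsGoodField K := by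
  have h1 : UDef.{u} (α := Empty) fun K _ _ _ => ∀ c : K, ∃ y, y * y = c :=
    UDef.all_one (P := fun K _ _ _ c => ∃ y, y * y = c)
      (UDef.ex_one (P := fun K _ _ v y => y * y = v (Sum.inr ()))
        (UDef.eq ((UFun.var _).mul (UFun.var _)) (UFun.var _)))
  have h2 {α : Type} [Finite α] (i : α) : UDef.{u} fun K _ _ v => ∀ t : K, v i ≠ t * t + t :=
    UDef.all_one (P := fun K _ _ v t => v i ≠ t * t + t)
      (UDef.eq (UFun.var _) (((UFun.var _).mul (UFun.var _)).add (UFun.var _))).not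
  have h3 : UDef.{u} (α := Empty) fun K _ _ _ => ∃ d : K, ∀ t, d ≠ t * t + t :=
    UDef.ex_one (P := fun K _ _ _ d => ∀ t, d ≠ t * t + t) (h2 _)
  have h4 : UDef.{u} (α := Empty) fun K _ _ _ => ∀ a b : K, (∀ t, a ≠ t * t + t) →
      (∀ t, b ≠ t * t + t) → ∃ t, a + b = t * t + t := by
    refine UDef.all_one (P := fun K _ _ _ a => ∀ b, (∀ t, a ≠ t * t + t) →
      (∀ t, b ≠ t * t + t) → ∃ t, a + b = t * t + t) (UDef.all_one (P := fun K _ _ v b =>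
      (∀ t, v (Sum.inr ()) ≠ t * t + t) →
      (∀ t, b ≠ t * t + t) → ∃ t, v (Sum.inr ()) + b = t * t + t)
      ((h2 _).imp ((h2 _).imp ?_)))
    exact UDef.ex_one (P := fun K _ _ v t => v (Sum.inl (Sum.inr ())) + v (Sum.inr ()) = t * t + t)
      (UDef.eq ((UFun.var _).add (UFun.var _)) (((UFun.var _).mul (UFun.var _)).add (UFun.var _)))
  exact (h1.and (h3.and h4)).congr fun K _ _ _ =>
    ⟨fun ⟨h1, h2, h3⟩ => ⟨h1, h2, h3⟩, fun ⟨h1, h2, h3⟩ => ⟨h1, h2, h3⟩⟩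

/-- The additive map `t ↦ t² + t` in characteristic two. -/
def artinSchreier (K : Type u) [Field K] [CharP K 2] : K →+ K where
  toFun t := t * t + t
  map_zero' := by simp
  map_add' a b := by
    have : a * b + b * a = 0 := by rw [mul_comm b a, CharTwo.add_self_eq_zero]
    linear_combination this

/-- The kernel of `t ↦ t² + t` is `{0, 1}`, so its image has index two in a finite field. -/
theorem index_range_artinSchreier (K : Type u) [Field K] [Finite K] [CharP K 2] :
    (artinSchreier K).range.index = 2 := by
  have h1 := AddSubgroup.card_mul_index (artinSchreier K).ker
  have h2 := AddSubgroup.card_mul_index (artinSchreier K).range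
  rw [AddSubgroup.index_ker] at h1
  have h3 : Nat.card (artinSchreier K).ker = 2 := by
    rw [Nat.card_eq_two_iff]
    refine ⟨0, ⟨1, ?_⟩, ?_, ?_⟩
    · simp [AddMonoidHom.mem_ker, artinSchreier, CharTwo.add_self_eq_zero]
    · simp [Subtype.ext_iff]
    · refine Set.eq_univ_of_forall fun ⟨x, hx⟩ => ?_
      have hx' : x * (x + 1) = 0 := by
        rw [mul_add, mul_one]
        exact hx
      rcases mul_eq_zero.1 hx' with h | h
      · exact Or.inl (Subtype.ext h)
      · exact Or.inr (Subtype.ext (CharTwo.add_eq_zero.1 h))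
  have h4 : 0 < Nat.card (artinSchreier K).range := Nat.card_pos
  rw [h3, ← h2, mul_comm] at h1
  exact (Nat.eq_of_mul_eq_mul_left h4 h1).symm

theorem isGoodField_of_finite (K : Type u) [Field K] [Finite K] [CharP K 2] : IsGoodField K := by
  have hi := index_range_artinSchreier K
  have hmem (d : K) : d ∈ (artinSchreier K).range ↔ ∃ t, d = t * t + t :=
    ⟨fun ⟨t, ht⟩ => ⟨t, ht.symm⟩, fun ⟨t, ht⟩ => ⟨t, ht.symm⟩⟩
  refine ⟨fun c => ?_, ?_, fun a b ha hb => ?_⟩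
  · obtain ⟨y, hy⟩ := FiniteField.isSquare_of_char_two (ringChar.eq K 2 ▸ rfl) c
    exact ⟨y, hy.symm⟩
  · by_contra! h
    have : (artinSchreier K).range = ⊤ := eq_top_iff.2 fun d _ => (hmem d).2 (h d)
    rw [this, AddSubgroup.index_top] at hi
    omega
  · rw [← hmem, AddSubgroup.add_mem_iff_of_index_two hi, hmem, hmem]
    exact ⟨fun ⟨t, ht⟩ => absurd ht (ha t), fun ⟨t, ht⟩ => absurd ht (hb t)⟩

theorem charP_two_of_ringEquiv {R S : Type*} [Field R] [Field S] [CharP R 2] (f : R ≃+* S) :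
    CharP S 2 :=
  charP_of_injective_ringHom (f := f.toRingHom) f.injective 2

theorem realize_sentence_congr {R S : Type*} [Field R] [Field S] [Ring.CompatibleRing R]
    [Ring.CompatibleRing S] (f : R ≃+* S) (φ : Language.ring.Sentence) : R ⊨ φ ↔ S ⊨ φ :=
  Language.StrongHomClass.realize_sentence (FirstOrder.Ring.languageEquivEquivRingEquiv.symm f) φ

/-- Sentences true in a model of `PSF₂` are true in some finite field of characteristic two. -/
theorem exists_finite_field {K : Type u} [Language.ring.Structure K] (hK : K ⊨ PSF₂)
    {ψ : Language.ring.Sentence} (hψ : K ⊨ ψ) :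
    ∃ (F : Type u) (_ : Field F) (_ : Ring.CompatibleRing F) (_ : CharP F 2), Finite F ∧ F ⊨ ψ := by
  by_contra! h
  have hmem : ψ.not ∈ PSF₂ := by
    refine Or.inl fun F _ _ _ _ => ?_
    rw [Language.Sentence.realize_not]
    intro hF
    let _ := FirstOrder.Ring.compatibleRingOfRing (ULift.{u} F)
    have : CharP (ULift.{u} F) 2 :=
      charP_two_of_ringEquiv (ULift.ringEquiv (R := F)).symm
    exact h (ULift.{u} F) inferInstance inferInstance inferInstance inferInstance
      ((realize_sentence_congr ULift.ringEquiv ψ).2 hF)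
  exact (Language.Sentence.realize_not K).1
    (Language.Theory.realize_sentence_of_mem (M := K) PSF₂ hmem) hψ

/-- Sentences true in all finite fields of characteristic two in the universe `u` are in `PSF₂`. -/
theorem mem_PSF₂ {φ : Language.ring.Sentence} (h : ∀ (F : Type u) [Field F] [Finite F] [CharP F 2]
    [Ring.CompatibleRing F], F ⊨ φ) : φ ∈ PSF₂ := by
  refine Or.inl fun F _ _ _ _ => ?_
  let _ := FirstOrder.Ring.compatibleRingOfRing (ULift.{u} F)
  have : CharP (ULift.{u} F) 2 :=
    charP_two_of_ringEquiv (ULift.ringEquiv (R := F)).symm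
  exact (realize_sentence_congr ULift.ringEquiv φ).1 (h (ULift.{u} F))

theorem realize_of_forall_finite {φ : Language.ring.Sentence} (h : ∀ (F : Type) [Field F] [Finite F]
    [CharP F 2] [Ring.CompatibleRing F], F ⊨ φ) (F : Type u) [Field F] [Finite F] [CharP F 2]
    [Ring.CompatibleRing F] : F ⊨ φ := by
  let _ := FirstOrder.Ring.compatibleRingOfRing (Shrink.{0} F)
  have : CharP (Shrink.{0} F) 2 :=
    charP_two_of_ringEquiv (Shrink.ringEquiv.{0} F).symm
  exact (realize_sentence_congr (Shrink.ringEquiv.{0} F) φ).1 (h (Shrink.{0} F))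

/-- A uniformly definable property of all finite fields of characteristic two holds in all fields
that are models of `PSF₂`. -/
theorem transfer_PSF₂ {P : ∀ (K : Type u) [Field K] [Ring.CompatibleRing K], Prop}
    (hP : UDef (α := Empty) fun K _ _ _ => P K)
    (h : ∀ (F : Type u) [Field F] [Ring.CompatibleRing F] [CharP F 2] [Finite F], P F)
    (K : Type u) [Field K] [Ring.CompatibleRing K] (hK : K ⊨ PSF₂) : P K := by
  obtain ⟨ψ, hψ⟩ := hP.exists_sentence
  rw [← hψ]
  exact Language.Theory.realize_sentence_of_mem (M := K) PSF₂
    (mem_PSF₂.{u} fun F _ _ _ _ => (hψ F).2 (h F))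

theorem charP_of_PSF₂ (K : Type u) [Field K] [Ring.CompatibleRing K] (hK : K ⊨ PSF₂) :
    CharP K 2 := by
  have h : (1 + 1 : K) = 0 := transfer_PSF₂ (P := fun K _ _ => (1 + 1 : K) = 0)
    (UDef.eq (UFun.one.add UFun.one) UFun.zero)
    (fun F _ _ _ _ => CharTwo.add_self_eq_zero 1) K hK
  exact CharTwo.of_one_ne_zero_of_two_eq_zero one_ne_zero (by rw [← one_add_one_eq_two, h])

theorem isGoodField_of_PSF₂ (K : Type u) [Field K] [Ring.CompatibleRing K] (hK : K ⊨ PSF₂) :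
    IsGoodField K :=
  transfer_PSF₂ udef_isGoodField (fun F _ _ _ _ => isGoodField_of_finite F) K hK

theorem field_subset_PSF₂ : Language.Theory.field ⊆ PSF₂ :=
  fun _ hφ => Or.inl fun F _ _ _ _ =>
    Language.Theory.realize_sentence_of_mem (M := F) Language.Theory.field hφ

/-- A completion of `PSF₂` has a model in every universe, which is an infinite field. -/
theorem IsCompletionOfPSF₂.exists_model {T : Language.ring.Theory} (hT : IsCompletionOfPSF₂ T) :
    ∃ (K : Type u) (_ : Field K) (_ : Ring.CompatibleRing K), K ⊨ T ∧ K ⊨ PSF₂ ∧ Infinite K := by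
  obtain ⟨M⟩ := hT.1.1
  let K := M.ulift.{0, 0, 0, u}
  have h1 : K ⊨ T := K.is_model
  have h2 : K ⊨ PSF₂ := h1.mono hT.2
  have h3 : K ⊨ Language.Theory.field := h2.mono field_subset_PSF₂
  have h4 : Infinite K := (Language.model_infiniteTheory_iff Language.ring).1
    (h2.mono Set.subset_union_right)
  let _ : Field K := FirstOrder.Field.fieldOfModelField K
  exact ⟨K, _, FirstOrder.Field.compatibleRingOfModelField K, h1, h2, h4⟩

theorem IsCompletionOfPSF₂.realize_iff {T : Language.ring.Theory} (hT : IsCompletionOfPSF₂ T)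
    {K L : Type*} [Language.ring.Structure K] [Language.ring.Structure L] (hK : K ⊨ T) (hL : L ⊨ T)
    (ψ : Language.ring.Sentence) : K ⊨ ψ ↔ L ⊨ ψ := by
  rcases hT.1.mem_or_not_mem ψ with h | h
  · exact iff_of_true (Language.Theory.realize_sentence_of_mem (M := K) T h)
      (Language.Theory.realize_sentence_of_mem (M := L) T h)
  · exact iff_of_false
      ((Language.Sentence.realize_not K).1 (Language.Theory.realize_sentence_of_mem (M := K) T h))
      ((Language.Sentence.realize_not L).1 (Language.Theory.realize_sentence_of_mem (M := L) T h))

end Fields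

/-! ### Semantics of dimension and Witt defect -/

section Invariants

variable {K V : Type u} [Field K] [Ring.CompatibleRing K] [AddCommGroup V] [Module K V] {q : V → K}

theorem satisfies_dimGE (d : ℕ) :
    (orthStructure q).Satisfies (dimGE d) ↔ (d : Cardinal) ≤ Module.rank K V := by
  rw [Module.le_rank_iff]
  simp [LStructure.Satisfies, dimGE]

theorem isModel_dimInfinite :
    (orthStructure q).IsModel dimInfinite ↔ ∀ d : ℕ, (d : Cardinal) ≤ Module.rank K V := by
  rw [dimInfinite, isModel_range]
  simp only [satisfies_dimGE]

theorem isModel_dimEq (d : ℕ) :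
    (orthStructure q).IsModel (dimEq d) ↔ Module.rank K V = d := by
  have h1 : (orthStructure q).Satisfies (dimGE (d + 1)).not ↔
      ¬ (orthStructure q).Satisfies (dimGE (d + 1)) := Iff.rfl
  simp only [LStructure.IsModel, dimEq, Set.mem_insert_iff, Set.mem_singleton_iff, forall_eq_or_imp,
    forall_eq, h1, satisfies_dimGE]
  rw [Nat.cast_add_one, ← Cardinal.succ_natCast, Order.succ_le_iff, not_lt, and_comm,
    ← le_antisymm_iff]

theorem satisfies_wittIndexGE (r : ℕ) :
    (orthStructure q).Satisfies (wittIndexGE r) ↔ WittIndexGE q r := by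
  simp [LStructure.Satisfies, wittIndexGE, WittIndexGE]

theorem isModel_wittDefectEq (n e : ℕ) :
    (orthStructure q).IsModel (wittDefectEq n e) ↔
      WittIndexGE q (n - e) ∧ ¬ WittIndexGE q (n - e + 1) := by
  have h1 : (orthStructure q).Satisfies (wittIndexGE (n - e + 1)).not ↔
      ¬ (orthStructure q).Satisfies (wittIndexGE (n - e + 1)) := Iff.rfl
  simp only [LStructure.IsModel, wittDefectEq, Set.mem_insert_iff, Set.mem_singleton_iff,
    forall_eq_or_imp, forall_eq, h1, satisfies_wittIndexGE]

theorem orthStructure_isModel [CharP K 2] {Q : QuadraticForm K V} (hQ : PolarNondegenerate Q) :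
    (orthStructure Q).IsModel orthogonalTheory :=
  moduleStructure_isModel_iff.2 ⟨CharTwo.add_self_eq_zero 1, rfl, ⟨Q, rfl⟩, hQ⟩

theorem satisfies_map {W : Type u} [AddCommGroup W] [Module K W] {q' : W → K} (f : V ≃ₗ[K] W)
    (hq : ∀ x, q' (f x) = q x) (φ : LSentence) :
    (orthStructure q').Satisfies φ ↔ (orthStructure q).Satisfies φ := by
  refine Iff.trans (iff_of_eq ?_) (LFormula.realize_map f hq φ Fin.elim0 Fin.elim0)
  exact congrArg (φ.Realize (orthStructure q') Fin.elim0) (Subsingleton.elim (α := Fin 0 → W) _ _)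

/-- Truth of a sentence in the structure on `K^ι` given by a uniformly definable `q` is uniformly
definable in the parameters of `q`. -/
theorem udef_satisfies {ι π : Type} [Fintype ι] [Finite π]
    {q : ∀ (K : Type u) [Field K] [Ring.CompatibleRing K], (π → K) → (ι → K) → K}
    (hq : UFun (α := π ⊕ ι) fun K _ _ v =>
      q K (fun i => v (Sum.inl i)) (fun i => v (Sum.inr i))) (φ : LSentence) :
    UDef (α := π) fun K _ _ v => (orthStructure (q K v)).Satisfies φ := by
  have hempty : IsEmpty (Fin 0 ⊕ Fin 0 × ι) := inferInstance
  refine (UDef.reindex (formulaDef hq φ)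
    (Sum.elim (fun x => hempty.elim x) id : Ctx 0 0 ι π → π)).congr fun K _ _ v => ?_
  exact iff_of_eq (congrArg₂ (φ.Realize (orthStructure (q K v)))
    (Subsingleton.elim (α := Fin 0 → K) _ _) (Subsingleton.elim (α := Fin 0 → ι → K) _ _))

end Invariants

/-! ### Elimination of the vector sort in finite dimension -/

section FiniteDimension

theorem ufun_stdForm (k : ℕ) : UFun.{u} (α := Unit ⊕ Fin (k + 1) × Bool) fun K _ _ v =>
    stdForm k K (v (Sum.inl ())) fun i => v (Sum.inr i) :=
  ((((UFun.var _).mul (UFun.var _)).add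
    ((UFun.var _).mul ((UFun.var _).mul (UFun.var _)))).add
    (UFun.sum fun _ => (UFun.var _).mul (UFun.var _)))

/-- Over a good field, the dimension, the Witt defect and a parameter `d` determine the form: the
space has a standard basis with parameter `d`, provided that `d` is of the form `t² + t` if and only
if the defect is `0`. -/
theorem exists_isStandard_of_defect {K V : Type u} [Field K] [AddCommGroup V] [Module K V]
    [CharP K 2] {Q : QuadraticForm K V} (hK : IsGoodField K) (hQ : PolarNondegenerate Q) {k e : ℕ}
    (he : e ≤ 1) (hV : Module.finrank K V = 2 * (k + 1)) (h1 : WittIndexGE Q (k + 1 - e))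
    (h2 : ¬ WittIndexGE Q (k + 1 - e + 1)) {d : K} (hd : (∃ t, d = t * t + t) ↔ e = 0) :
    ∃ b : Fin (k + 1) × Bool → V, IsStandard Q b d := by
  have hfin : Module.Finite K V := Module.finite_of_finrank_pos (by omega)
  obtain ⟨k', d₀, hk', b, hb⟩ := exists_isStandard hK.sq hQ (by omega)
  obtain rfl : k = k' := by omega
  have hd₀ : (∃ t, d₀ = t * t + t) ↔ e = 0 := by
    constructor
    · intro h
      by_contra hne
      obtain rfl : e = 1 := by omega
      exact h2 (hb.wittIndexGE_succ h)
    · rintro rfl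
      by_contra h
      exact hb.not_wittIndexGE_succ hV h h1
  have hadd : ∃ t, d₀ + d = t * t + t := by
    by_cases h : e = 0
    · obtain ⟨s, hs⟩ := hd₀.2 h
      obtain ⟨t, ht⟩ := hd.2 h
      refine ⟨s + t, ?_⟩
      rw [hs, ht]
      exact ((artinSchreier K).map_add s t).symm
    · refine hK.exists_add _ _ (fun t ht => h (hd₀.1 ⟨t, ht⟩)) fun t ht => h (hd.1 ⟨t, ht⟩)
  obtain ⟨t, ht⟩ := hadd
  exact hb.change ht

theorem IsGoodField.exists_param {K : Type u} [Field K] (hK : IsGoodField K) (e : ℕ) :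
    ∃ d : K, (∃ t, d = t * t + t) ↔ e = 0 := by
  by_cases he : e = 0
  · exact ⟨0, iff_of_true ⟨0, by simp⟩ he⟩
  · obtain ⟨d, hd⟩ := hK.exists_ne
    exact ⟨d, iff_of_false (fun ⟨t, ht⟩ => hd t ht) he⟩

/-- For spaces of dimension `2n` and Witt defect `e` over good fields, the truth of a sentence
depends only on the truth of a sentence in the field. -/
theorem exists_sentence_of_rank_eq (φ : LSentence) (n e : ℕ) (he : e ≤ 1) (hen : e ≤ n) :
    ∃ ψ : Language.ring.Sentence,
    ∀ (K V : Type u) [Field K] [Ring.CompatibleRing K] [AddCommGroup V] [Module K V] [CharP K 2]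
    (Q : QuadraticForm K V), IsGoodField K → PolarNondegenerate Q →
    Module.rank K V = (2 * n : ℕ) → WittIndexGE Q (n - e) → ¬ WittIndexGE Q (n - e + 1) →
    ((orthStructure Q).Satisfies φ ↔ K ⊨ ψ) := by
  rcases n with _ | k
  · obtain ⟨ψ, hψ⟩ := ((udef_satisfies.{u} (ι := Empty) (π := Empty) (q := fun _ _ _ _ _ => 0)
      UFun.zero φ).congr (Q := fun K _ _ _ =>
        (orthStructure (V := Empty → K) (fun _ => (0 : K))).Satisfies φ) fun _ _ _ _ =>
        Iff.rfl).exists_sentence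
    refine ⟨ψ, fun K V _ _ _ _ _ Q _ _ hV _ _ => ?_⟩
    have hsub : Subsingleton V := rank_zero_iff.1 (by simpa using hV)
    rw [hψ]
    exact satisfies_map (0 : (Empty → K) ≃ₗ[K] V) (fun x => Q.map_zero) φ
  · have hdef := udef_satisfies.{u} (ι := Fin (k + 1) × Bool) (π := Unit)
      (q := fun K _ _ v => stdForm k K (v ())) (ufun_stdForm k) φ
    -- The truth value is the same for all admissible `d`, so that `d` can be quantified away.
    have hall : UDef.{u} (α := Empty) fun K _ _ _ => ∀ d : K, ((∃ t, d = t * t + t) ↔ e = 0) →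
        (orthStructure (stdForm k K d)).Satisfies φ := by
      refine UDef.all_one (P := fun K _ _ _ d => ((∃ t, d = t * t + t) ↔ e = 0) →
        (orthStructure (stdForm k K d)).Satisfies φ) (UDef.imp ?_ (hdef.reindex Sum.inr))
      have h1 : UDef.{u} (α := Empty ⊕ Unit) fun K _ _ v => ∃ t, v (Sum.inr ()) = t * t + t :=
        UDef.ex_one (P := fun K _ _ v t => v (Sum.inr ()) = t * t + t)
          (UDef.eq (UFun.var _) (((UFun.var _).mul (UFun.var _)).add (UFun.var _)))
      by_cases he0 : e = 0
      · exact h1.congr fun K _ _ v => by simp [he0]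
      · exact h1.not.congr fun K _ _ v => by simp [he0]
    obtain ⟨ψ, hψ⟩ := hall.exists_sentence
    refine ⟨ψ, fun K V _ _ _ _ _ Q hK hQ hV h1 h2 => ?_⟩
    have hV' : Module.finrank K V = 2 * (k + 1) := Module.finrank_eq_of_rank_eq hV
    have key (d : K) (hd : (∃ t, d = t * t + t) ↔ e = 0) : (orthStructure Q).Satisfies φ ↔
        (orthStructure (stdForm k K d)).Satisfies φ := by
      obtain ⟨b, hb⟩ := exists_isStandard_of_defect hK hQ he hV' h1 h2 hd
      obtain ⟨f, -, hf⟩ := hb.exists_equiv hV'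
      exact satisfies_map f hf φ
    rw [hψ]
    obtain ⟨d, hd⟩ := hK.exists_param e
    exact ⟨fun h d hd => (key d hd).1 h, fun h => (key d hd).2 (h d hd)⟩

end FiniteDimension

/-! ### Construction of orthogonal spaces -/

section Models

variable (K : Type u) [Field K]

theorem dualProd_nondegenerate (W : Type u) [AddCommGroup W] [Module K W] :
    PolarNondegenerate (QuadraticForm.dualProd K W) := by
  rintro ⟨f, w⟩ h
  have h1 (w' : W) : f w' = 0 := by
    have := h (0, w')
    simpa [QuadraticMap.polar] using this
  have h2 (g : Module.Dual K W) : g w = 0 := by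
    have := h (g, 0)
    simpa [QuadraticMap.polar] using this
  exact Prod.ext (LinearMap.ext h1) ((Module.forall_dual_apply_eq_zero_iff K w).1 h2)

theorem rank_le_rank_dualProd (W : Type u) [AddCommGroup W] [Module K W] :
    Module.rank K W ≤ Module.rank K (Module.Dual K W × W) :=
  LinearMap.rank_le_of_injective (LinearMap.inr K _ _) LinearMap.inr_injective

theorem le_rank_dualProd (d : ℕ) :
    (d : Cardinal) ≤ Module.rank K (Module.Dual K (ℕ →₀ K) × (ℕ →₀ K)) := by
  refine le_trans ?_ (rank_le_rank_dualProd K (ℕ →₀ K))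
  simp

variable {K}

/-- Over good fields, all dimensions `2n` and Witt defects `e ≤ min 1 n` are realized. -/
theorem IsGoodField.exists_form [CharP K 2] (hK : IsGoodField K) {n e : ℕ} (he : e ≤ 1)
    (hen : e ≤ n) : ∃ (ι : Type) (_ : Fintype ι) (Q : QuadraticForm K (ι → K)),
      PolarNondegenerate Q ∧ Module.rank K (ι → K) = (2 * n : ℕ) ∧ WittIndexGE Q (n - e) ∧
      ¬ WittIndexGE Q (n - e + 1) := by
  rcases n with _ | k
  · have hQ : PolarNondegenerate (0 : QuadraticForm K (Empty → K)) :=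
      fun x _ => Subsingleton.elim _ _
    refine ⟨Empty, inferInstance, 0, hQ, by simp, ?_, fun h => ?_⟩
    · obtain rfl : e = 0 := by omega
      change WittIndexGE _ 0
      exact ⟨Fin.elim0, linearIndependent_empty_type, fun i => i.elim0, fun i => i.elim0⟩
    · have := h.two_mul_le hQ
      simp at this
  · obtain ⟨d, hd⟩ := hK.exists_param e
    let p (z : Fin (k + 1) × Bool) : (Fin (k + 1) × Bool → K) →ₗ[K] K := LinearMap.proj z
    let Q : QuadraticForm K (Fin (k + 1) × Bool → K) :=
      QuadraticMap.linMulLin (p (Fin.last k, false)) (p (Fin.last k, false)) +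
      d • QuadraticMap.linMulLin (p (Fin.last k, true)) (p (Fin.last k, true)) +
      ∑ i, QuadraticMap.linMulLin (p (i, false)) (p (i, true))
    have hQ (c) : Q c = stdForm k K d c := by
      simp [Q, stdForm, p]
    have hpol (x y) : QuadraticMap.polar Q x y =
        ∑ i, (x (i, false) * y (i, true) + x (i, true) * y (i, false)) := by
      have h2 : (2 : K) = 0 := CharTwo.two_eq_zero
      have hsum : ∑ i, (x (i, false) + y (i, false)) * (x (i, true) + y (i, true)) =
          ∑ i, x (i, false) * x (i, true) + ∑ i, y (i, false) * y (i, true) +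
          ∑ i, (x (i, false) * y (i, true) + x (i, true) * y (i, false)) := by
        rw [← Finset.sum_add_distrib, ← Finset.sum_add_distrib]
        exact Finset.sum_congr rfl fun i _ => by ring
      rw [QuadraticMap.polar, hQ, hQ, hQ]
      simp only [stdForm, Pi.add_apply]
      linear_combination hsum + (x (Fin.last k, false) * y (Fin.last k, false) +
        d * (x (Fin.last k, true) * y (Fin.last k, true))) * h2
    have hstd : IsStandard Q (fun z => Pi.single z 1) d := by
      refine ⟨?_, ?_, ?_, ?_⟩
      · rintro ⟨i, a⟩ ⟨j, b⟩
        rw [hpol]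
        rcases a with _ | _ <;> rcases b with _ | _ <;> by_cases hij : i = j <;>
          simp [Pi.single_apply, hij, eq_comm (a := j)]
      · intro i a
        rw [hQ, stdForm]
        rcases a with _ | _ <;> simp [Pi.single_apply, (Fin.castSucc_lt_last i).ne']
      · rw [hQ, stdForm]
        simp [Pi.single_apply]
      · rw [hQ, stdForm]
        simp [Pi.single_apply]
    have hV : Module.finrank K (Fin (k + 1) × Bool → K) = 2 * (k + 1) := by
      simp [mul_comm]
    have hnd : PolarNondegenerate Q := by
      intro x hx
      funext ⟨i, a⟩
      have h1 := hstd.symplectic.polar_sum x i (!a)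
      rw [← pi_eq_sum_univ' x, hx, Bool.not_not] at h1
      exact h1.symm
    refine ⟨Fin (k + 1) × Bool, inferInstance, Q, hnd, ?_, ?_⟩
    · rw [← Module.finrank_eq_rank, hV]
    · by_cases he0 : e = 0
      · subst he0
        refine ⟨hstd.wittIndexGE_succ (hd.2 rfl), fun h => ?_⟩
        have := h.two_mul_le hnd
        omega
      · obtain rfl : e = 1 := by omega
        exact ⟨hstd.wittIndexGE, hstd.not_wittIndexGE_succ hV fun h => he0 (hd.1 h)⟩

end Models

/-! ### Axiomatizations of complete theories -/

section Axiomatizations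

theorem isAxiomatizedBy_of_forall {M : LStructure.{u}} {Γ : Set LSentence}
    (hM : M.IsModel orthogonalTheory) (hΓ : M.IsModel Γ)
    (h : ∀ N : LStructure.{u}, N.IsModel orthogonalTheory → N.IsModel Γ →
      ∀ φ, M.Satisfies φ ↔ N.Satisfies φ) : IsAxiomatizedBy M Γ := by
  refine Set.ext fun φ => ⟨fun hφ N hN => ?_, fun hφ => ?_⟩
  · have := LStructure.isModel_union.1 hN
    exact (h N this.1 this.2 φ).1 hφ
  · exact hφ M (LStructure.isModel_union.2 ⟨hM, hΓ⟩)

variable {K V : Type u} [Field K] [Ring.CompatibleRing K] [AddCommGroup V] [Module K V] [CharP K 2]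
  {Q : QuadraticForm K V}

/-- If the models of `Γ` have good fields that are elementarily equivalent to `K`, then `Γ` and
infinite dimension axiomatize a complete theory. -/
theorem isAxiomatizedBy_dimInfinite (hK : IsGoodField K) (hQ : PolarNondegenerate Q)
    (hV : ∀ d : ℕ, (d : Cardinal) ≤ Module.rank K V) {Γ : Set LSentence}
    (hΓ : (orthStructure Q).IsModel Γ)
    (h : ∀ (L W : Type u) [Field L] [Ring.CompatibleRing L] [AddCommGroup W] [Module L W]
      [CharP L 2] (R : QuadraticForm L W), (orthStructure R).IsModel Γ →
      IsGoodField L ∧ ∀ ψ : Language.ring.Sentence, K ⊨ ψ ↔ L ⊨ ψ) :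
    IsAxiomatizedBy (orthStructure Q) (Γ ∪ dimInfinite) := by
  refine isAxiomatizedBy_of_forall (orthStructure_isModel hQ)
    (LStructure.isModel_union.2 ⟨hΓ, isModel_dimInfinite.2 hV⟩) fun N hN hN' φ => ?_
  obtain ⟨L, W, _, _, _, _, _, R, hR, rfl⟩ := exists_eq_orthStructure hN
  obtain ⟨hN1, hN2⟩ := LStructure.isModel_union.1 hN'
  obtain ⟨hL, hKL⟩ := h L W R hN1
  obtain ⟨n, ψ, hψ⟩ := exists_sentence_of_large_rank.{u} φ
  rw [hψ K V Q hK.sq hQ (hV n), hψ L W R hL.sq hR (isModel_dimInfinite.1 hN2 n), hKL]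

theorem isAxiomatizedBy_fieldTheory_dimInfinite (hQ : PolarNondegenerate Q)
    (hV : ∀ d : ℕ, (d : Cardinal) ≤ Module.rank K V) {T : Language.ring.Theory}
    (hT : IsCompletionOfPSF₂ T) (hKT : K ⊨ T) :
    IsAxiomatizedBy (orthStructure Q) (fieldTheory T ∪ dimInfinite) := by
  refine isAxiomatizedBy_dimInfinite (isGoodField_of_PSF₂ K (hKT.mono hT.2)) hQ hV
    ((isModel_fieldTheory T).2 hKT) fun L W _ _ _ _ _ R hR => ?_
  have hL : L ⊨ T := (isModel_fieldTheory T).1 hR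
  exact ⟨isGoodField_of_PSF₂ L (hL.mono hT.2), hT.realize_iff hKT hL⟩

theorem isAxiomatizedBy_fieldCard_dimInfinite (hQ : PolarNondegenerate Q)
    (hV : ∀ d : ℕ, (d : Cardinal) ≤ Module.rank K V) {k : ℕ} (hk : Cardinal.mk K = (2 ^ k : ℕ)) :
    IsAxiomatizedBy (orthStructure Q) (fieldCard (2 ^ k) ∪ dimInfinite) := by
  have hfin {L : Type u} (hL : Cardinal.mk L = (2 ^ k : ℕ)) : Finite L :=
    Cardinal.mk_lt_aleph0_iff.1 (hL ▸ Cardinal.natCast_lt_aleph0)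
  have := hfin hk
  refine isAxiomatizedBy_dimInfinite (isGoodField_of_finite K) hQ hV
    ((isModel_fieldCard _).2 hk) fun L W _ _ _ _ _ R hR => ?_
  have hL : Cardinal.mk L = (2 ^ k : ℕ) := (isModel_fieldCard _).1 hR
  have := hfin hL
  let _ := Fintype.ofFinite K
  let _ := Fintype.ofFinite L
  refine ⟨isGoodField_of_finite L, realize_sentence_congr (FiniteField.ringEquivOfCardEq ?_)⟩
  rw [← hL, Cardinal.mk_fintype, Cardinal.mk_fintype] at hk
  exact_mod_cast hk

theorem isAxiomatizedBy_wittDefectEq (hQ : PolarNondegenerate Q) {T : Language.ring.Theory}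
    (hT : IsCompletionOfPSF₂ T) (hKT : K ⊨ T) {n e : ℕ} (he : e ≤ 1) (hen : e ≤ n)
    (hV : Module.rank K V = (2 * n : ℕ)) (h1 : WittIndexGE Q (n - e))
    (h2 : ¬ WittIndexGE Q (n - e + 1)) :
    IsAxiomatizedBy (orthStructure Q)
      (fieldTheory T ∪ dimEq (2 * n) ∪ wittDefectEq n e) := by
  refine isAxiomatizedBy_of_forall (orthStructure_isModel hQ)
    (LStructure.isModel_union.2 ⟨LStructure.isModel_union.2 ⟨(isModel_fieldTheory T).2 hKT,
      (isModel_dimEq _).2 hV⟩, (isModel_wittDefectEq n e).2 ⟨h1, h2⟩⟩) fun N hN hN' φ => ?_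
  obtain ⟨L, W, _, _, _, _, _, R, hR, rfl⟩ := exists_eq_orthStructure hN
  obtain ⟨hN1, hN2⟩ := LStructure.isModel_union.1 hN'
  obtain ⟨hN0, hN1⟩ := LStructure.isModel_union.1 hN1
  have hL : L ⊨ T := (isModel_fieldTheory T).1 hN0
  obtain ⟨h3, h4⟩ := (isModel_wittDefectEq n e).1 hN2
  obtain ⟨ψ, hψ⟩ := exists_sentence_of_rank_eq.{u} φ n e he hen
  rw [hψ K V Q (isGoodField_of_PSF₂ K (hKT.mono hT.2)) hQ hV h1 h2,
    hψ L W R (isGoodField_of_PSF₂ L (hL.mono hT.2)) hR ((isModel_dimEq _).1 hN1) h3 h4,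
    hT.realize_iff hKT hL]

end Axiomatizations

/-! ### Pseudo-finiteness -/

section Pseudofinite

variable {K V : Type u} [Field K] [AddCommGroup V] [Module K V]
  {Q : QuadraticForm K V}

/-- Infinite-dimensional spaces are pseudo-finite if every ring sentence true in the field is true
in a finite field, as hyperbolic spaces of large finite dimension approximate them. -/
theorem isPseudofinite_of_infinite_dim [Ring.CompatibleRing K] [CharP K 2] (hK : IsGoodField K)
    (hQ : PolarNondegenerate Q) (hV : ∀ d : ℕ, (d : Cardinal) ≤ Module.rank K V)
    (h : ∀ ψ : Language.ring.Sentence, K ⊨ ψ → ∃ (F : Type u) (_ : Field F)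
      (_ : Ring.CompatibleRing F) (_ : CharP F 2), Finite F ∧ F ⊨ ψ) :
    IsPseudofinite (orthStructure Q) := by
  refine ⟨orthStructure_isModel hQ, Or.inr ?_, fun φ hφ => ?_⟩
  · by_contra hfin
    have : Finite V := not_infinite_iff_finite.1 hfin
    have := hV (Module.finrank K V + 1)
    rw [← Module.finrank_eq_rank] at this
    norm_cast at this
    omega
  · obtain ⟨n, ψ, hψ⟩ := exists_sentence_of_large_rank.{u} φ
    obtain ⟨F, _, _, _, hF, hFψ⟩ := h ψ ((hψ K V Q hK.sq hQ (hV n)).1 hφ)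
    have hnd := dualProd_nondegenerate F (Fin n → F)
    have : Finite (Module.Dual F (Fin n → F)) := DFunLike.finite _
    refine ⟨orthStructure (QuadraticForm.dualProd F (Fin n → F)), orthStructure_isModel hnd, hF,
      inferInstanceAs (Finite (Module.Dual F (Fin n → F) × (Fin n → F))),
      (hψ F _ _ (isGoodField_of_finite F).sq hnd ?_).2 hFψ⟩
    refine le_trans ?_ (rank_le_rank_dualProd F (Fin n → F))
    rw [rank_fun', Fintype.card_fin]

/-- Finite-dimensional spaces over pseudo-finite fields are pseudo-finite. -/
theorem isPseudofinite_of_rank_eq [Ring.CompatibleRing K] [CharP K 2] [Infinite K]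
    (hK : K ⊨ PSF₂) (hQ : PolarNondegenerate Q) {n e : ℕ} (he : e ≤ 1) (hen : e ≤ n)
    (hV : Module.rank K V = (2 * n : ℕ)) (h1 : WittIndexGE Q (n - e))
    (h2 : ¬ WittIndexGE Q (n - e + 1)) : IsPseudofinite (orthStructure Q) := by
  refine ⟨orthStructure_isModel hQ, Or.inl ‹_›, fun φ hφ => ?_⟩
  obtain ⟨ψ, hψ⟩ := exists_sentence_of_rank_eq.{u} φ n e he hen
  obtain ⟨F, _, _, _, hF, hFψ⟩ := exists_finite_field hK
    ((hψ K V Q (isGoodField_of_PSF₂ K hK) hQ hV h1 h2).1 hφ)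
  have hgood := isGoodField_of_finite F
  obtain ⟨ι, _, R, hR, hι, h3, h4⟩ := hgood.exists_form he hen
  exact ⟨orthStructure R, orthStructure_isModel hR, hF, inferInstanceAs (Finite (ι → F)),
    (hψ F _ R hgood hR hι h3 h4).2 hFψ⟩

/-- The field of a pseudo-finite orthogonal space is a model of `PSF₂` if it is infinite. -/
theorem realize_PSF₂_of_isPseudofinite [Ring.CompatibleRing K] [Infinite K]
    (h : IsPseudofinite (orthStructure Q)) :
    K ⊨ PSF₂ := by
  refine Language.Theory.model_iff _ |>.2 fun φ hφ => ?_
  rcases hφ with hφ | hφ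
  · by_contra hK
    obtain ⟨N, hN, hNK, -, hNφ⟩ := h.2.2 (fieldSentence φ.not)
      ((satisfies_fieldSentence _).2 ((Language.Sentence.realize_not K).2 hK))
    obtain ⟨L, W, _, _, _, _, _, R, -, rfl⟩ := exists_eq_orthStructure hN
    have hL : Finite L := hNK
    exact (Language.Sentence.realize_not L).1 ((satisfies_fieldSentence _).1 hNφ)
      (realize_of_forall_finite hφ L)
  · exact Language.Theory.realize_sentence_of_mem (M := K) Language.ring.infiniteTheory hφ

/-- A space over a good field is infinite-dimensional, or has dimension `2n` and Witt defect
`e ≤ min 1 n`. -/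
theorem IsGoodField.infinite_dim_or [CharP K 2] (hK : IsGoodField K) (hQ : PolarNondegenerate Q) :
    (∀ d : ℕ, (d : Cardinal) ≤ Module.rank K V) ∨ ∃ n e, e ≤ 1 ∧ e ≤ n ∧
      Module.rank K V = (2 * n : ℕ) ∧ WittIndexGE Q (n - e) ∧ ¬ WittIndexGE Q (n - e + 1) := by
  refine or_iff_not_imp_left.2 fun h => ?_
  push Not at h
  obtain ⟨d, hd⟩ := h
  have : Module.Finite K V := Module.rank_lt_aleph0_iff.1 (hd.trans Cardinal.natCast_lt_aleph0)
  rw [← Module.finrank_eq_rank]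
  by_cases h0 : Module.finrank K V = 0
  · refine ⟨0, 0, by simp, le_rfl, by simp [h0], ?_, fun h => ?_⟩
    · change WittIndexGE _ 0
      exact ⟨Fin.elim0, linearIndependent_empty_type, fun i => i.elim0, fun i => i.elim0⟩
    · have := h.two_mul_le hQ
      omega
  · obtain ⟨k, d, hk, b, hb⟩ := exists_isStandard hK.sq hQ (Nat.pos_of_ne_zero h0)
    by_cases hd : ∃ t, d = t * t + t
    · refine ⟨k + 1, 0, by simp, by simp, by rw [hk], hb.wittIndexGE_succ hd, fun h => ?_⟩
      have := h.two_mul_le hQ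
      omega
    · exact ⟨k + 1, 1, le_rfl, by simp, by rw [hk], hb.wittIndexGE,
        hb.not_wittIndexGE_succ hk hd⟩

end Pseudofinite

end OrthogonalSpaces

theorem mainTheorem2 :
    (∀ M : OrthogonalSpaces.LStructure.{u}, OrthogonalSpaces.IsPseudofinite M →
      (∃ k : ℕ, 1 ≤ k ∧ OrthogonalSpaces.IsAxiomatizedBy M
        (OrthogonalSpaces.fieldCard (2 ^ k) ∪ OrthogonalSpaces.dimInfinite)) ∨
      (∃ T : Language.ring.Theory, OrthogonalSpaces.IsCompletionOfPSF₂ T ∧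
        ((∃ n e : ℕ, e ≤ 1 ∧ e ≤ n ∧ OrthogonalSpaces.IsAxiomatizedBy M
            (OrthogonalSpaces.fieldTheory T ∪ OrthogonalSpaces.dimEq (2 * n) ∪
              OrthogonalSpaces.wittDefectEq n e)) ∨
          OrthogonalSpaces.IsAxiomatizedBy M
            (OrthogonalSpaces.fieldTheory T ∪ OrthogonalSpaces.dimInfinite)))) ∧
    (∀ k : ℕ, 1 ≤ k → ∃ M : OrthogonalSpaces.LStructure.{u},
      OrthogonalSpaces.IsPseudofinite M ∧ OrthogonalSpaces.IsAxiomatizedBy M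
        (OrthogonalSpaces.fieldCard (2 ^ k) ∪ OrthogonalSpaces.dimInfinite)) ∧
    (∀ T : Language.ring.Theory, OrthogonalSpaces.IsCompletionOfPSF₂ T →
      (∀ n e : ℕ, e ≤ 1 → e ≤ n → ∃ M : OrthogonalSpaces.LStructure.{u},
        OrthogonalSpaces.IsPseudofinite M ∧ OrthogonalSpaces.IsAxiomatizedBy M
          (OrthogonalSpaces.fieldTheory T ∪ OrthogonalSpaces.dimEq (2 * n) ∪
            OrthogonalSpaces.wittDefectEq n e)) ∧
      (∃ M : OrthogonalSpaces.LStructure.{u},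
        OrthogonalSpaces.IsPseudofinite M ∧ OrthogonalSpaces.IsAxiomatizedBy M
          (OrthogonalSpaces.fieldTheory T ∪ OrthogonalSpaces.dimInfinite))) := by
  refine ⟨fun M hM => ?_, fun k hk => ?_, fun T hT => ⟨fun n e he hen => ?_, ?_⟩⟩
  · obtain ⟨K, V, _, _, _, _, _, Q, hQ, rfl⟩ := OrthogonalSpaces.exists_eq_orthStructure hM.1
    rcases finite_or_infinite K with hK | hK
    · left
      let _ := Fintype.ofFinite K
      obtain ⟨k, -, hk⟩ := FiniteField.card K 2
      have hV : Infinite V := hM.2.1.resolve_left (not_infinite_iff_finite.2 hK)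
      refine ⟨k, k.2, OrthogonalSpaces.isAxiomatizedBy_fieldCard_dimInfinite hQ ?_
        (by rw [Cardinal.mk_fintype, hk])⟩
      by_contra! h
      obtain ⟨d, hd⟩ := h
      have : Module.Finite K V :=
        Module.rank_lt_aleph0_iff.1 (hd.trans Cardinal.natCast_lt_aleph0)
      exact not_finite_iff_infinite.2 hV (Module.finite_of_finite K)
    · right
      have hPSF := OrthogonalSpaces.realize_PSF₂_of_isPseudofinite hM
      have hKT : K ⊨ Language.ring.completeTheory K :=
        (Language.Theory.model_iff _).2 fun φ hφ => hφ
      have hT : OrthogonalSpaces.IsCompletionOfPSF₂ (Language.ring.completeTheory K) :=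
        ⟨Language.completeTheory.isMaximal _ _,
          fun φ hφ => (Language.Theory.model_iff _).1 hPSF φ hφ⟩
      refine ⟨_, hT, ?_⟩
      rcases (OrthogonalSpaces.isGoodField_of_PSF₂ K hPSF).infinite_dim_or hQ with
        hV | ⟨n, e, he, hen, hV, h1, h2⟩
      · exact Or.inr
          (OrthogonalSpaces.isAxiomatizedBy_fieldTheory_dimInfinite hQ hV hT hKT)
      · exact Or.inl ⟨n, e, he, hen,
          OrthogonalSpaces.isAxiomatizedBy_wittDefectEq hQ hT hKT he hen hV h1 h2⟩
  · let K := ULift.{u} (GaloisField 2 k)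
    let _ : Ring.CompatibleRing K := FirstOrder.Ring.compatibleRingOfRing K
    have : CharP K 2 := OrthogonalSpaces.charP_two_of_ringEquiv
      (ULift.ringEquiv (R := GaloisField 2 k)).symm
    have hcard : Nat.card K = 2 ^ k := by
      rw [Nat.card_congr Equiv.ulift, GaloisField.card 2 k (by omega)]
    have hfin : Finite K := Nat.finite_of_card_ne_zero (by rw [hcard]; positivity)
    have hQ := OrthogonalSpaces.dualProd_nondegenerate K (ℕ →₀ K)
    exact ⟨_, OrthogonalSpaces.isPseudofinite_of_infinite_dim
      (OrthogonalSpaces.isGoodField_of_finite K) hQ (OrthogonalSpaces.le_rank_dualProd K)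
        fun ψ hψ => ⟨K, inferInstance, inferInstance, inferInstance, hfin, hψ⟩,
      OrthogonalSpaces.isAxiomatizedBy_fieldCard_dimInfinite hQ
        (OrthogonalSpaces.le_rank_dualProd K)
        (by rw [← hcard, Nat.cast_card])⟩
  · obtain ⟨K, _, _, hKT, hPSF, _⟩ := hT.exists_model.{u}
    have := OrthogonalSpaces.charP_of_PSF₂ K hPSF
    obtain ⟨ι, _, Q, hQ, hV, h1, h2⟩ :=
      (OrthogonalSpaces.isGoodField_of_PSF₂ K hPSF).exists_form he hen
    exact ⟨OrthogonalSpaces.orthStructure Q,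
      OrthogonalSpaces.isPseudofinite_of_rank_eq hPSF hQ he hen hV h1 h2,
      OrthogonalSpaces.isAxiomatizedBy_wittDefectEq hQ hT hKT he hen hV h1 h2⟩
  · obtain ⟨K, _, _, hKT, hPSF, _⟩ := hT.exists_model.{u}
    have := OrthogonalSpaces.charP_of_PSF₂ K hPSF
    have hQ := OrthogonalSpaces.dualProd_nondegenerate K (ℕ →₀ K)
    exact ⟨_, OrthogonalSpaces.isPseudofinite_of_infinite_dim
      (OrthogonalSpaces.isGoodField_of_PSF₂ K hPSF) hQ (OrthogonalSpaces.le_rank_dualProd K)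
        fun ψ hψ => OrthogonalSpaces.exists_finite_field hPSF hψ,
      OrthogonalSpaces.isAxiomatizedBy_fieldTheory_dimInfinite hQ
        (OrthogonalSpaces.le_rank_dualProd K) hT hKT⟩
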